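/- Let $S$ be a finite set of (colored) steps, each of which is of type $\nearrow$ (height change $+1$), $\searrow$ (height change $-1$) or $\rightarrow$ (height change $0$), and assume that the numbers of $\nearrow$ steps and of $\searrow$ steps in $S$ are equal and positive (the number of $\rightarrow$ steps is arbitrary, possibly $0$). The Florentine algorithm with target size $n$ builds a path, starting from the empty path at height $0$, by appending independent uniformly random steps of $S$ one at a time. Whenever the path steps below its origin, it is discarded and the algorithm starts over from the empty path; as soon as the current path has length $n$, the algorithm stops and outputs it (a prefix of a colored Motzkin path). Let $Y_n$ be the total number of steps drawn by the algorithm, including those of the discarded paths. For $0<\alpha<1$, the Darling–Mandelbrot distribution of parameter $\alpha$ is the probability distribution supported on $[0,\infty)$ with characteristic function $$\phi_\alpha(s)=\Bigl(1-\sum_{k=1}^\infty\frac{\alpha}{k-\alpha}\,\frac{(is)^k}{k!}\Bigr)^{-1},$$ and $\mathcal D(\alpha)$ denotes this distribution shifted by one, with characteristic function $e^{is}\phi_\alpha(s)$. Then the algorithm terminates almost surely, the law $\mathcal D(\frac12)$ exists, and, as $n\to\infty$, the random variable $Y_n/n$ converges in distribution to $\mathcal D(\frac12)$. Moreover $Y_n$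 has a finite second moment for every $n$, and $$\mathbb E(Y_n)\sim 2n,\qquad \mathbb V(Y_n)\sim\tfrac43\,n^2.$$ -/

import Mathlib

open MeasureTheory ProbabilityTheory Filter Topology
open scoped ENNReal Asymptotics

/-- The three kinds of steps of a Motzkin path. -/
inductive MotzkinKind where
  | up
  | down
  | level
  deriving DecidableEq

/-- The vertical displacement of a step: `+1`, `-1` or `0`. -/
def MotzkinKind.rise : MotzkinKind → ℤ
  | .up => 1
  | .down => -1
  | .level => 0

section Florentine

variable {S : Type*} (kind : S → MotzkinKind)

/-- The final height, relative to the origin, of a path with steps in `S`, where the (coloured)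
step `s` is of the kind `kind s`. -/
def pathHeight (p : List S) : ℤ := (p.map fun s => (kind s).rise).sum

/-- The path held by the Florentine algorithm after it has drawn the steps `w 0, …, w (m - 1)`.
Each drawn step is appended to the current path; if the path thereby steps below the origin, it is
thrown away and the algorithm starts over from the empty path. -/
def florentinePath (w : ℕ → S) : ℕ → List S
  | 0 => []
  | m + 1 =>
    if 0 ≤ pathHeight kind (florentinePath w m ++ [w m]) then florentinePath w m ++ [w m] else []

/-- The Florentine algorithm with target size `n`, fed with the steps `w`, terminates. -/
def FlorentineTerminates (w : ℕ → S) (n : ℕ) : Prop :=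
  ∃ m, (florentinePath kind w m).length = n

/-- The number of steps drawn by the Florentine algorithm with target size `n`, which stops as soon
as its current path has length `n` (with the value `0` if it never stops). -/
noncomputable def florentineCost (w : ℕ → S) (n : ℕ) : ℕ :=
  sInf {m | (florentinePath kind w m).length = n}

end Florentine

/-- The function `φ_α(s) = (1 - ∑_{n ≥ 1} α / (n - α) * (i s)^n / n!)⁻¹`. -/
noncomputable def darlingMandelbrotCharFun (α s : ℝ) : ℂ :=
  (1 - ∑' n : ℕ, (α : ℂ) / (((n + 1 : ℕ) : ℂ) - α) *
    ((Complex.I * s) ^ (n + 1) / ((n + 1).factorial : ℂ)))⁻¹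

/-- `μ` is the Darling–Mandelbrot distribution of parameter `α`: it is supported on `[0, ∞)` and
has the characteristic function `φ_α`. -/
structure IsDarlingMandelbrot (α : ℝ) (μ : ProbabilityMeasure ℝ) : Prop where
  support_nonneg : (μ : Measure ℝ) (Set.Iio 0) = 0
  charFun_eq : ∀ s : ℝ, charFun (μ : Measure ℝ) s = darlingMandelbrotCharFun α s

/-- `ν` is the law `𝒟(α)`, the Darling–Mandelbrot distribution of parameter `α` shifted by one. -/
def IsShiftedDarlingMandelbrot (α : ℝ) (ν : ProbabilityMeasure ℝ) : Prop :=
  ∃ μ : ProbabilityMeasure ℝ, IsDarlingMandelbrot α μ ∧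
    (ν : Measure ℝ) = (μ : Measure ℝ).map fun x => x + 1

/-!
Let `q k` be the probability that the walk with the drawn steps stays nonnegative for `k` steps.
A run either reaches length `n`, or fails at some step `k + 1 ≤ n`, and then the algorithm starts
afresh, independently of the past. The cost `Y n` therefore satisfies a renewal equation, which
expresses the characteristic function of `Y n / n - 1` as `(1 - ∑_{j ≥ 1} m_j(n) (i s) ^ j / j!)⁻¹`,
where `m_j(n)` is the `j`-th moment of the failure step divided by `n`, restricted to the failures
up to step `n`, over `q n`; its mean and variance are `m_1(n)` and `m_1(n) ^ 2 + m_2(n)`.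

As soon as `q n ~ c * n ^ (-α)`, the Stolz–Cesàro theorem gives `m_j(n) → α / (j - α)`, so that
Lévy's continuity theorem yields the limit law `𝒟(α)`. Here `α = 1 / 2`: diagonalizing the walk
killed below the origin shows that `q n = π⁻¹ ∫_0^π (1 + cos t) (1 - 2 p (1 - cos t)) ^ n dt`, where
`p` is the probability of an up step, and Laplace's method gives `√n * q n → (π p) ^ (-1 / 2)`.
-/

/-- The series `∑_{k ≥ 1} a k * (i s) ^ k / k!`. When `a` is the sequence of moments of a finite
measure, this is its characteristic function at `s`, minus its total mass. -/
noncomputable def momentSeries (a : ℕ → ℝ) (s : ℝ) : ℂ :=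
  ∑' k : ℕ, (a (k + 1) : ℂ) * ((Complex.I * s) ^ (k + 1) / ((k + 1).factorial : ℂ))

section MomentSeries

theorem hasSum_pow_succ_div_factorial {𝕂 : Type*} [RCLike 𝕂] (z : 𝕂) :
    HasSum (fun k : ℕ => z ^ (k + 1) / ((k + 1).factorial : 𝕂)) (NormedSpace.exp z - 1) := by
  simpa using (hasSum_nat_add_iff' 1).2 (NormedSpace.expSeries_div_hasSum_exp z)

theorem norm_momentSeries_term (a s : ℝ) (k : ℕ) :
    ‖(a : ℂ) * ((Complex.I * s) ^ k / (k.factorial : ℂ))‖ = |a| * (|s| ^ k / k.factorial) := by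
  simp

theorem norm_momentSeries_le {a : ℕ → ℝ} {C : ℝ} (ha : ∀ k, |a (k + 1)| ≤ C) (s : ℝ) :
    ‖momentSeries a s‖ ≤ C * (Real.exp |s| - 1) := by
  rw [Real.exp_eq_exp_ℝ]
  refine tsum_of_norm_bounded ((hasSum_pow_succ_div_factorial |s|).mul_left C) fun k => ?_
  rw [norm_momentSeries_term]
  exact mul_le_mul_of_nonneg_right (ha k) (by positivity)

theorem tendsto_momentSeries {ι : Type*} {l : Filter ι} {a : ι → ℕ → ℝ} {b : ℕ → ℝ} {C : ℝ}
    (ha : ∀ᶠ i in l, ∀ k, |a i (k + 1)| ≤ C)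
    (hab : ∀ k, Tendsto (fun i => a i (k + 1)) l (𝓝 (b (k + 1)))) (s : ℝ) :
    Tendsto (fun i => momentSeries (a i) s) l (𝓝 (momentSeries b s)) := by
  refine tendsto_tsum_of_dominated_convergence
    ((hasSum_pow_succ_div_factorial |s|).mul_left C).summable
    (fun k => ((Complex.continuous_ofReal.tendsto _).comp (hab k)).mul_const _) ?_
  filter_upwards [ha] with i hi k
  rw [norm_momentSeries_term]
  exact mul_le_mul_of_nonneg_right (hi k) (by positivity)

theorem momentSeries_sum_mul_pow {ι : Type*} (t : Finset ι) (w x : ι → ℝ) (s : ℝ) :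
    momentSeries (fun k => ∑ i ∈ t, w i * x i ^ k) s =
      ∑ i ∈ t, (w i : ℂ) * (Complex.exp (Complex.I * s * x i) - 1) := by
  simp only [Complex.exp_eq_exp_ℂ]
  rw [← (hasSum_sum fun i _ =>
    (hasSum_pow_succ_div_factorial (Complex.I * s * x i)).mul_left (w i : ℂ)).tsum_eq]
  refine tsum_congr fun k => ?_
  rw [Complex.ofReal_sum, Finset.sum_mul]
  refine Finset.sum_congr rfl fun i _ => ?_
  push_cast
  ring

theorem darlingMandelbrotCharFun_eq_momentSeries (α s : ℝ) :
    darlingMandelbrotCharFun α s = (1 - momentSeries (fun k => α / (k - α)) s)⁻¹ := by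
  simp [darlingMandelbrotCharFun, momentSeries]

theorem continuousAt_darlingMandelbrotCharFun {α : ℝ} (hα₀ : 0 ≤ α) (hα₁ : α < 1) :
    ContinuousAt (darlingMandelbrotCharFun α) 0 := by
  have h_le (k : ℕ) : |α / ((k + 1 : ℕ) - α)| ≤ α / (1 - α) := by
    have h_denom : 1 - α ≤ (k + 1 : ℕ) - α := by simp
    rw [abs_of_nonneg (div_nonneg hα₀ ((sub_nonneg.2 hα₁.le).trans h_denom))]
    exact div_le_div_of_nonneg_left hα₀ (sub_pos.2 hα₁) h_denom
  have h_zero : Tendsto (momentSeries fun k => α / (k - α)) (𝓝 0) (𝓝 0) := by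
    refine squeeze_zero_norm (norm_momentSeries_le h_le) ?_
    have h_cont : Continuous fun s : ℝ => α / (1 - α) * (Real.exp |s| - 1) := by fun_prop
    simpa using h_cont.tendsto 0
  have h_inv := (h_zero.const_sub 1).inv₀ (by simp)
  have h_val : darlingMandelbrotCharFun α 0 = (1 - 0)⁻¹ := by
    simp [darlingMandelbrotCharFun]
  rw [ContinuousAt, h_val]
  exact h_inv.congr fun s => (darlingMandelbrotCharFun_eq_momentSeries α s).symm

end MomentSeries

/-- `q` is the survival function `n ↦ ℙ(T > n)` of a random time `T` with values in
`{1, 2, …} ∪ {∞}` and without a deterministic upper bound; `ℙ(T = n + 1)` is then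
`q n - q (n + 1)`. -/
structure IsSurvivalFunction (q : ℕ → ℝ) : Prop where
  map_zero : q 0 = 1
  antitone : Antitone q
  pos : ∀ n, 0 < q n

namespace IsSurvivalFunction

variable {q : ℕ → ℝ} (hq : IsSurvivalFunction q)
include hq

theorem sub_succ_nonneg (k : ℕ) : 0 ≤ q k - q (k + 1) :=
  sub_nonneg.2 (hq.antitone k.le_succ)

theorem sum_sub_succ (n : ℕ) : ∑ k ∈ Finset.range n, (q k - q (k + 1)) = 1 - q n := by
  rw [Finset.sum_range_sub', hq.map_zero]

end IsSurvivalFunction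

/-- The moment `𝔼[(T / n) ^ j ; T ≤ n] / ℙ(T > n)` of a random time `T` with survival function
`q`. -/
noncomputable def truncatedMoment (q : ℕ → ℝ) (j n : ℕ) : ℝ :=
  (∑ k ∈ Finset.range n, (q k - q (k + 1)) * (((k : ℝ) + 1) / n) ^ j) / q n

section TruncatedMoment

theorem tendsto_rpow_succ_sub_rpow_div (r : ℝ) :
    Tendsto (fun k : ℕ => (((k : ℝ) + 1) ^ r - (k : ℝ) ^ r) / (k : ℝ) ^ (r - 1)) atTop (𝓝 r) := by
  have h_deriv : HasDerivAt (fun x : ℝ => x ^ r) r 1 := by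
    simpa using Real.hasDerivAt_rpow_const (x := 1) (p := r) (Or.inl one_ne_zero)
  have h_inv : Tendsto (fun k : ℕ => (k : ℝ)⁻¹) atTop (𝓝[≠] 0) := by
    refine tendsto_nhdsWithin_iff.2 ⟨tendsto_inv_atTop_nhds_zero_nat, ?_⟩
    filter_upwards [eventually_gt_atTop 0] with k hk
    simp [hk.ne']
  refine (h_deriv.tendsto_slope_zero.comp h_inv).congr' ?_
  filter_upwards [eventually_gt_atTop 0] with k hk
  have hk' : (0 : ℝ) < k := by exact_mod_cast hk
  have h_factor : (k : ℝ) + 1 = k * (1 + (k : ℝ)⁻¹) := by field_simp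
  have h_ne : (k : ℝ) ^ r ≠ 0 := (Real.rpow_pos_of_pos hk' r).ne'
  simp only [Function.comp, inv_inv, smul_eq_mul, Real.one_rpow]
  rw [h_factor, Real.mul_rpow hk'.le (by positivity), Real.rpow_sub_one hk'.ne']
  field_simp

/-- The Stolz–Cesàro theorem. -/
theorem tendsto_sum_div_sum {a b : ℕ → ℝ} {l : ℝ} (hb : ∀ k, 0 < b k)
    (hb_sum : Tendsto (fun n => ∑ k ∈ Finset.range n, b k) atTop atTop)
    (hab : Tendsto (fun k => a k / b k) atTop (𝓝 l)) :
    Tendsto (fun n => (∑ k ∈ Finset.range n, a k) / ∑ k ∈ Finset.range n, b k) atTop (𝓝 l) := by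
  have h_little : (fun k => a k - l * b k) =o[atTop] b := by
    rw [Asymptotics.isLittleO_iff_tendsto' (.of_forall fun k h => absurd h (hb k).ne')]
    refine (tendsto_sub_nhds_zero_iff.2 hab).congr fun k => ?_
    have := (hb k).ne'
    field_simp
  have h_sum := (h_little.sum_range (fun k => (hb k).le) hb_sum).tendsto_div_nhds_zero
  refine tendsto_sub_nhds_zero_iff.1 (h_sum.congr' ?_)
  filter_upwards [hb_sum.eventually_gt_atTop 0] with n hn
  rw [Finset.sum_sub_distrib, ← Finset.mul_sum, sub_div, mul_div_cancel_right₀ _ hn.ne']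

theorem sum_sub_succ_mul_pow (q : ℕ → ℝ) {j : ℕ} (hj : j ≠ 0) (n : ℕ) :
    ∑ k ∈ Finset.range n, (q k - q (k + 1)) * ((k : ℝ) + 1) ^ j =
      ∑ k ∈ Finset.range n, q k * (((k : ℝ) + 1) ^ j - (k : ℝ) ^ j) - q n * (n : ℝ) ^ j := by
  induction n with
  | zero => simp [hj]
  | succ n ih =>
    rw [Finset.sum_range_succ, Finset.sum_range_succ, ih]
    push_cast
    ring

theorem pow_mul_truncatedMoment (q : ℕ → ℝ) (j n : ℕ) :
    (n : ℝ) ^ j * truncatedMoment q j n =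
      (∑ k ∈ Finset.range n, (q k - q (k + 1)) * ((k : ℝ) + 1) ^ j) / q n := by
  rcases n.eq_zero_or_pos with rfl | hn
  · simp [truncatedMoment]
  · rw [truncatedMoment, mul_div_assoc', Finset.mul_sum]
    congr 1
    refine Finset.sum_congr rfl fun k _ => ?_
    rw [div_pow]
    field_simp

theorem momentSeries_truncatedMoment (q : ℕ → ℝ) (n : ℕ) (s : ℝ) :
    momentSeries (truncatedMoment q · n) s =
      (∑ k ∈ Finset.range n, ((q k - q (k + 1) : ℝ) : ℂ) *
        (Complex.exp (Complex.I * s * (((k : ℝ) + 1) / n : ℝ)) - 1)) / (q n : ℂ) := by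
  rw [← momentSeries_sum_mul_pow, momentSeries, momentSeries, ← tsum_div_const]
  refine tsum_congr fun k => ?_
  rw [truncatedMoment, Complex.ofReal_div]
  ring

theorem tendsto_sum_mul_pow_sub_div_rpow {q : ℕ → ℝ} {α c : ℝ}
    (hq : Tendsto (fun n : ℕ => (n : ℝ) ^ α * q n) atTop (𝓝 c)) {j : ℕ} (hj : α < j) :
    Tendsto (fun n : ℕ => (∑ k ∈ Finset.range n, q k * (((k : ℝ) + 1) ^ j - (k : ℝ) ^ j)) /
      (n : ℝ) ^ (j - α)) atTop (𝓝 (c * j / (j - α))) := by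
  have hr : 0 < j - α := sub_pos.2 hj
  have h_pos (k : ℕ) : 0 < ((k : ℝ) + 1) ^ (j - α) - (k : ℝ) ^ (j - α) :=
    sub_pos.2 (Real.rpow_lt_rpow k.cast_nonneg (lt_add_one _) hr)
  have h_sum (n : ℕ) : ∑ k ∈ Finset.range n, (((k : ℝ) + 1) ^ (j - α) - (k : ℝ) ^ (j - α)) =
      (n : ℝ) ^ (j - α) := by
    simpa [Real.zero_rpow hr.ne'] using Finset.sum_range_sub (fun k : ℕ => (k : ℝ) ^ (j - α)) n
  have h_top : Tendsto (fun n : ℕ => (n : ℝ) ^ (j - α)) atTop atTop :=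
    (tendsto_rpow_atTop hr).comp tendsto_natCast_atTop_atTop
  have h_ratio : Tendsto (fun k : ℕ => q k * (((k : ℝ) + 1) ^ j - (k : ℝ) ^ j) /
      (((k : ℝ) + 1) ^ (j - α) - (k : ℝ) ^ (j - α))) atTop (𝓝 (c * j / (j - α))) := by
    refine ((hq.mul (tendsto_rpow_succ_sub_rpow_div j)).div
      (tendsto_rpow_succ_sub_rpow_div (j - α)) hr.ne').congr' ?_
    filter_upwards [eventually_gt_atTop 0] with k hk
    have hk' : (0 : ℝ) < k := by exact_mod_cast hk
    have h_split : (k : ℝ) ^ ((j : ℝ) - 1) = (k : ℝ) ^ (j - α - 1) * (k : ℝ) ^ α := by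
      rw [← Real.rpow_add hk']
      congr 1
      ring
    have h_ne := (h_pos k).ne'
    have h_rpow_sub := (Real.rpow_pos_of_pos hk' (j - α - 1)).ne'
    have h_rpow := (Real.rpow_pos_of_pos hk' α).ne'
    simp only [Pi.div_apply, h_split, Real.rpow_natCast]
    field_simp
  simpa only [h_sum] using tendsto_sum_div_sum h_pos (by simpa only [h_sum] using h_top) h_ratio

theorem tendsto_truncatedMoment {q : ℕ → ℝ} {α c : ℝ} (hc : c ≠ 0)
    (hq : Tendsto (fun n : ℕ => (n : ℝ) ^ α * q n) atTop (𝓝 c)) {j : ℕ} (hj₀ : j ≠ 0)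
    (hj : α < j) : Tendsto (truncatedMoment q j) atTop (𝓝 (α / (j - α))) := by
  have h_lim := ((tendsto_sum_mul_pow_sub_div_rpow hq hj).div hq hc).sub_const 1
  have h_val : c * j / (j - α) / c - 1 = α / (j - α) := by
    have := (sub_pos.2 hj).ne'
    field_simp
    ring
  rw [h_val] at h_lim
  refine h_lim.congr' ?_
  filter_upwards [eventually_gt_atTop 0, hq.eventually_ne hc] with n hn hqn
  have hn' : (0 : ℝ) < n := by exact_mod_cast hn
  have h_split : (n : ℝ) ^ j = (n : ℝ) ^ (j - α) * (n : ℝ) ^ α := by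
    rw [← Real.rpow_natCast, ← Real.rpow_add hn', sub_add_cancel]
  have h_rpow_sub := (Real.rpow_pos_of_pos hn' (j - α)).ne'
  have h_rpow := left_ne_zero_of_mul hqn
  have h_qn := right_ne_zero_of_mul hqn
  have h_pow : (n : ℝ) ^ j ≠ 0 := by positivity
  rw [← mul_right_inj' h_pow, pow_mul_truncatedMoment, sum_sub_succ_mul_pow q hj₀, Pi.div_apply,
    h_split]
  field_simp

theorem tendsto_momentSeries_truncatedMoment {q : ℕ → ℝ} (hq : IsSurvivalFunction q) {α c : ℝ}
    (hα : α < 1) (hc : c ≠ 0) (hqc : Tendsto (fun n : ℕ => (n : ℝ) ^ α * q n) atTop (𝓝 c))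
    (s : ℝ) : Tendsto (fun n => momentSeries (truncatedMoment q · n) s) atTop
      (𝓝 (momentSeries (fun k => α / (k - α)) s)) := by
  have h_tendsto (j : ℕ) :
      Tendsto (truncatedMoment q (j + 1)) atTop (𝓝 (α / ((j + 1 : ℕ) - α))) :=
    tendsto_truncatedMoment hc hqc j.succ_ne_zero (hα.trans_le (by simp))
  have h_anti (j n : ℕ) : |truncatedMoment q (j + 1) n| ≤ truncatedMoment q 1 n := by
    rw [truncatedMoment, truncatedMoment, abs_of_nonneg (div_nonneg (Finset.sum_nonneg fun k _ =>
      mul_nonneg (hq.sub_succ_nonneg k) (by positivity)) (hq.pos n).le)]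
    refine div_le_div_of_nonneg_right (Finset.sum_le_sum fun k hk => ?_) (hq.pos n).le
    have hk' : (k : ℝ) + 1 ≤ n := by exact_mod_cast Finset.mem_range.1 hk
    exact mul_le_mul_of_nonneg_left (pow_le_pow_of_le_one (by positivity)
      (div_le_one_of_le₀ hk' n.cast_nonneg) (Nat.le_add_left 1 j)) (hq.sub_succ_nonneg k)
  refine tendsto_momentSeries (C := α / ((0 + 1 : ℕ) - α) + 1) ?_ h_tendsto s
  filter_upwards [(h_tendsto 0).eventually_le_const (lt_add_one _)] with n hn j
  exact (h_anti j n).trans hn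

end TruncatedMoment

/-- The kernel whose integral against the powers of `1 - 2 * p * (1 - cos t)` is the probability
that a lazy simple walk started at height `h` stays positive. It equals
`sin (h * t) * cot (t / 2)`. -/
noncomputable def survivalKernel (h : ℕ) (t : ℝ) : ℝ :=
  ∑ j ∈ Finset.range h, (Real.cos (j * t) + Real.cos ((j + 1 : ℕ) * t))

section SurvivalKernel

@[fun_prop]
theorem continuous_survivalKernel (h : ℕ) : Continuous (survivalKernel h) := by
  unfold survivalKernel
  fun_prop

theorem survivalKernel_succ (h : ℕ) (t : ℝ) :
    survivalKernel (h + 1) t =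
      survivalKernel h t + (Real.cos (h * t) + Real.cos ((h + 1 : ℕ) * t)) :=
  Finset.sum_range_succ _ h

theorem two_mul_cos_mul_cos_succ_mul (j : ℕ) (t : ℝ) :
    2 * Real.cos t * Real.cos ((j + 1 : ℕ) * t) =
      Real.cos (j * t) + Real.cos ((j + 2 : ℕ) * t) := by
  rw [mul_right_comm, Real.two_mul_cos_mul_cos]
  push_cast
  ring_nf

theorem two_mul_cos_mul_survivalKernel_succ (h : ℕ) (t : ℝ) :
    2 * Real.cos t * survivalKernel (h + 1) t =
      survivalKernel (h + 2) t + survivalKernel h t := by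
  induction h with
  | zero =>
    simp only [survivalKernel, Finset.sum_range_succ, Finset.sum_range_zero]
    have := Real.cos_two_mul t
    push_cast
    simp only [zero_mul, zero_add, one_mul, Real.cos_zero]
    linear_combination -this
  | succ h ih =>
    rw [survivalKernel_succ (h + 1), survivalKernel_succ (h + 2)]
    linear_combination ih + two_mul_cos_mul_cos_succ_mul h t +
      two_mul_cos_mul_cos_succ_mul (h + 1) t - survivalKernel_succ h t

theorem integral_cos_nat_mul {m : ℕ} (hm : m ≠ 0) :
    ∫ t in (0 : ℝ)..Real.pi, Real.cos (m * t) = 0 := by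
  rw [intervalIntegral.integral_comp_mul_left (fun x => Real.cos x) (Nat.cast_ne_zero.2 hm),
    integral_cos]
  simp [Real.sin_nat_mul_pi]

theorem integral_survivalKernel_succ (h : ℕ) :
    ∫ t in (0 : ℝ)..Real.pi, survivalKernel (h + 1) t = Real.pi := by
  have h_cos (m : ℕ) : IntervalIntegrable (fun t => Real.cos (m * t)) volume 0 Real.pi :=
    Continuous.intervalIntegrable (by fun_prop) _ _
  induction h with
  | zero =>
    have h_one (t : ℝ) : survivalKernel (0 + 1) t = 1 + Real.cos ((1 : ℕ) * t) := by
      simp [survivalKernel]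
    simp only [h_one]
    rw [intervalIntegral.integral_add (by simp) (h_cos 1), integral_cos_nat_mul one_ne_zero]
    simp
  | succ h ih =>
    simp only [survivalKernel_succ (h + 1)]
    rw [intervalIntegral.integral_add ((continuous_survivalKernel _).intervalIntegrable _ _)
      ((h_cos _).add (h_cos _)), intervalIntegral.integral_add (h_cos _) (h_cos _), ih,
      integral_cos_nat_mul (by lia), integral_cos_nat_mul (by lia)]
    simp

/-- The recursion in the hypotheses is that of the probability `V n h` that a walk started at height
`h`, which steps up or down with probability `p` each, stays positive for `n` steps. -/
theorem eq_integral_survivalKernel {p : ℝ} {V : ℕ → ℕ → ℝ} (h_init : ∀ h, V 0 (h + 1) = 1)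
    (h_bdry : ∀ n, V n 0 = 0) (h_step : ∀ n h, V (n + 1) (h + 1) =
      p * V n (h + 2) + p * V n h + (1 - 2 * p) * V n (h + 1)) (n h : ℕ) :
    V n h = Real.pi⁻¹ * ∫ t in (0 : ℝ)..Real.pi,
      survivalKernel h t * (1 - 2 * p * (1 - Real.cos t)) ^ n := by
  induction n generalizing h with
  | zero =>
    rcases h with _ | h
    · simp [h_bdry, survivalKernel]
    · simp [h_init, integral_survivalKernel_succ, Real.pi_ne_zero]
  | succ n ih =>
    rcases h with _ | h
    · simp [h_bdry, survivalKernel]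
    have h_int (c : ℝ) (h : ℕ) : IntervalIntegrable (fun t => c * (survivalKernel h t *
        (1 - 2 * p * (1 - Real.cos t)) ^ n)) volume 0 Real.pi :=
      Continuous.intervalIntegrable (by fun_prop) _ _
    have h_kernel (t : ℝ) : survivalKernel (h + 1) t * (1 - 2 * p * (1 - Real.cos t)) ^ (n + 1) =
        p * (survivalKernel (h + 2) t * (1 - 2 * p * (1 - Real.cos t)) ^ n) +
        p * (survivalKernel h t * (1 - 2 * p * (1 - Real.cos t)) ^ n) +
        (1 - 2 * p) * (survivalKernel (h + 1) t * (1 - 2 * p * (1 - Real.cos t)) ^ n) := by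
      rw [pow_succ]
      linear_combination (p * (1 - 2 * p * (1 - Real.cos t)) ^ n) *
        two_mul_cos_mul_survivalKernel_succ h t
    simp only [h_kernel]
    rw [intervalIntegral.integral_add ((h_int _ _).add (h_int _ _)) (h_int _ _),
      intervalIntegral.integral_add (h_int _ _) (h_int _ _)]
    simp only [intervalIntegral.integral_const_mul]
    rw [h_step, ih, ih, ih]
    ring

end SurvivalKernel

section Laplace

theorem one_sub_pow_le_inv {x : ℝ} (hx₀ : 0 ≤ x) (hx₁ : x ≤ 1) (n : ℕ) :
    (1 - x) ^ n ≤ (1 + n * x)⁻¹ := by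
  rw [← one_div, le_div_iff₀ (by positivity)]
  calc (1 - x) ^ n * (1 + n * x) ≤ (1 - x) ^ n * (1 + x) ^ n :=
        mul_le_mul_of_nonneg_left (one_add_mul_le_pow (by linarith) n)
          (pow_nonneg (sub_nonneg.2 hx₁) n)
    _ = (1 - x ^ 2) ^ n := by rw [← mul_pow]; ring
    _ ≤ 1 := pow_le_one₀ (by nlinarith) (by nlinarith)

theorem norm_one_add_cos_mul_pow_le {p : ℝ} (hp₀ : 0 < p) (hp : p ≤ 1 / 2) {t : ℝ}
    (ht : |t| ≤ Real.pi) (n : ℕ) :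
    ‖(1 + Real.cos t) * (1 - 2 * p * (1 - Real.cos t)) ^ n‖ ≤
      (2 + Real.pi ^ 2 + Real.pi ^ 2 / (2 * p)) * (1 + n * t ^ 2)⁻¹ := by
  have h_lower := Real.neg_one_le_cos t
  have h_upper := Real.cos_le_one t
  have hn : (0 : ℝ) ≤ n := n.cast_nonneg
  have h_pos : 0 ≤ Real.pi ^ 2 / (2 * p) := by positivity
  rw [norm_mul, norm_pow, Real.norm_of_nonneg (by linarith), Real.norm_eq_abs]
  rcases le_total (2 * p * (1 - Real.cos t)) 1 with hy | hy
  · have h_quad : 4 * p / Real.pi ^ 2 * t ^ 2 ≤ 2 * p * (1 - Real.cos t) := by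
      have := mul_le_mul_of_nonneg_left (Real.cos_le_one_sub_mul_cos_sq ht) (mul_pos two_pos hp₀).le
      linear_combination this
    rw [abs_of_nonneg (by linarith)]
    calc (1 + Real.cos t) * (1 - 2 * p * (1 - Real.cos t)) ^ n
        ≤ 2 * (1 + n * (4 * p / Real.pi ^ 2 * t ^ 2))⁻¹ := by
          refine mul_le_mul (by linarith) ((one_sub_pow_le_inv (by nlinarith) hy n).trans ?_)
            (by positivity) zero_le_two
          gcongr
      _ ≤ _ := by
          rw [← div_eq_mul_inv, ← div_eq_mul_inv, div_le_div_iff₀ (by positivity) (by positivity)]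
          have h_cancel : Real.pi ^ 2 / (2 * p) * (n * (4 * p / Real.pi ^ 2 * t ^ 2)) =
              2 * (n * t ^ 2) := by
            have := Real.pi_ne_zero
            field_simp
            ring
          have h_rest : 0 ≤ (2 + Real.pi ^ 2) * (n * (4 * p / Real.pi ^ 2 * t ^ 2)) := by positivity
          nlinarith [sq_nonneg Real.pi]
  · rw [abs_of_nonpos (by linarith)]
    have h_base : -(1 - 2 * p * (1 - Real.cos t)) ≤ 1 - (1 + Real.cos t) := by nlinarith
    calc (1 + Real.cos t) * (-(1 - 2 * p * (1 - Real.cos t))) ^ n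
        ≤ (1 + Real.cos t) * (1 + n * (1 + Real.cos t))⁻¹ := by
          refine mul_le_mul_of_nonneg_left ?_ (by linarith)
          exact (pow_le_pow_left₀ (by linarith) h_base n).trans
            (one_sub_pow_le_inv (by linarith) (by linarith) n)
      _ ≤ _ := by
          rw [← div_eq_mul_inv, ← div_eq_mul_inv, div_le_div_iff₀ (by nlinarith) (by positivity)]
          have h_sq : n * (1 + Real.cos t) * t ^ 2 ≤ n * (1 + Real.cos t) * Real.pi ^ 2 :=
            mul_le_mul_of_nonneg_left (sq_le_sq' (neg_le_of_abs_le ht) (le_of_abs_le ht))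
              (mul_nonneg hn (by linarith))
          have h_rest : 0 ≤ n * (1 + Real.cos t) * (2 + Real.pi ^ 2 / (2 * p)) :=
            mul_nonneg (mul_nonneg hn (by linarith)) (by positivity)
          nlinarith [sq_nonneg Real.pi]

theorem tendsto_mul_one_sub_cos_div_sqrt (u : ℝ) :
    Tendsto (fun n : ℕ => (n : ℝ) * (1 - Real.cos (u / √(n : ℝ)))) atTop (𝓝 (u ^ 2 / 2)) := by
  have h_sinc : Tendsto (fun n : ℕ => u ^ 2 / 2 * Real.sinc (u / √(n : ℝ) / 2) ^ 2) atTop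
      (𝓝 (u ^ 2 / 2 * Real.sinc (0 / 2) ^ 2)) := by
    refine ((((Real.continuous_sinc.tendsto _).comp (Tendsto.div_const ?_ 2)).pow 2).const_mul _)
    exact tendsto_const_nhds.div_atTop (Real.tendsto_sqrt_atTop.comp tendsto_natCast_atTop_atTop)
  rw [zero_div, Real.sinc_zero, one_pow, mul_one] at h_sinc
  refine h_sinc.congr' ?_
  filter_upwards [eventually_gt_atTop 0] with n hn
  have hn' : (0 : ℝ) < n := by exact_mod_cast hn
  have h_half : 1 - Real.cos (u / √(n : ℝ)) = 2 * Real.sin (u / √(n : ℝ) / 2) ^ 2 := by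
    rw [Real.sin_sq_eq_half_sub, mul_div_cancel₀ _ (two_ne_zero' ℝ)]
    ring
  rcases eq_or_ne u 0 with rfl | hu
  · simp
  · rw [h_half, Real.sinc_of_ne_zero (by positivity)]
    field_simp
    rw [Real.sq_sqrt hn'.le, mul_comm]

theorem mul_intervalIntegral_eq_integral_indicator_comp_div (f : ℝ → ℝ) {a c : ℝ} (ha : 0 ≤ a)
    (hc : 0 < c) :
    c * ∫ t in (0 : ℝ)..a, f t =
      ∫ u in Set.Ioi (0 : ℝ), (Set.Iic (c * a)).indicator (fun u => f (u / c)) u := by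
  rw [setIntegral_indicator measurableSet_Iic, Set.Ioi_inter_Iic,
    ← intervalIntegral.integral_of_le (by positivity), intervalIntegral.integral_comp_div _ hc.ne',
    zero_div, mul_div_cancel_left₀ _ hc.ne', smul_eq_mul]

theorem norm_indicator_one_add_cos_mul_pow_le {p : ℝ} (hp₀ : 0 < p) (hp : p ≤ 1 / 2) {n : ℕ}
    (hn : 0 < n) {u : ℝ} (hu : 0 ≤ u) :
    ‖(Set.Iic (√(n : ℝ) * Real.pi)).indicator (fun u => (1 + Real.cos (u / √(n : ℝ))) *
        (1 - 2 * p * (1 - Real.cos (u / √(n : ℝ)))) ^ n) u‖ ≤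
      (2 + Real.pi ^ 2 + Real.pi ^ 2 / (2 * p)) * (1 + u ^ 2)⁻¹ := by
  have hn' : (0 : ℝ) < n := by exact_mod_cast hn
  rw [norm_indicator_eq_indicator_norm]
  refine Set.indicator_apply_le' (fun hu' => ?_) fun _ => by positivity
  have h_abs : |u / √(n : ℝ)| ≤ Real.pi := by
    rw [abs_of_nonneg (by positivity)]
    exact (div_le_iff₀' (Real.sqrt_pos.2 hn')).2 hu'
  have h_sq : n * (u / √(n : ℝ)) ^ 2 = u ^ 2 := by
    rw [div_pow, Real.sq_sqrt n.cast_nonneg, mul_div_cancel₀ _ hn'.ne']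
  simpa only [h_sq] using norm_one_add_cos_mul_pow_le hp₀ hp h_abs n

theorem tendsto_one_add_cos_mul_pow (p u : ℝ) :
    Tendsto (fun n : ℕ => (1 + Real.cos (u / √(n : ℝ))) *
      (1 - 2 * p * (1 - Real.cos (u / √(n : ℝ)))) ^ n) atTop (𝓝 (2 * Real.exp (-p * u ^ 2))) := by
  have h_zero : Tendsto (fun n : ℕ => u / √(n : ℝ)) atTop (𝓝 0) :=
    tendsto_const_nhds.div_atTop (Real.tendsto_sqrt_atTop.comp tendsto_natCast_atTop_atTop)
  have h_cos := ((Real.continuous_cos.tendsto 0).comp h_zero).const_add 1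
  rw [Real.cos_zero, one_add_one_eq_two] at h_cos
  refine h_cos.mul ?_
  simp only [sub_eq_add_neg (1 : ℝ) (2 * p * _)]
  refine Real.tendsto_one_add_pow_exp_of_tendsto ?_
  convert (tendsto_mul_one_sub_cos_div_sqrt u).const_mul (-(2 * p)) using 2 <;> ring

/-- Laplace's method: under `t = u / √n` the integrand tends to `2 * exp (-p * u ^ 2)`. -/
theorem tendsto_sqrt_mul_integral {p : ℝ} (hp₀ : 0 < p) (hp : p ≤ 1 / 2) :
    Tendsto (fun n : ℕ => √(n : ℝ) * ∫ t in (0 : ℝ)..Real.pi,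
      (1 + Real.cos t) * (1 - 2 * p * (1 - Real.cos t)) ^ n) atTop (𝓝 √(Real.pi / p)) := by
  have h_gauss : ∫ u in Set.Ioi (0 : ℝ), 2 * Real.exp (-p * u ^ 2) = √(Real.pi / p) := by
    rw [integral_const_mul, integral_gaussian_Ioi, mul_div_cancel₀ _ two_ne_zero]
  have h_lim : Tendsto (fun n : ℕ => ∫ u in Set.Ioi (0 : ℝ),
      (Set.Iic (√(n : ℝ) * Real.pi)).indicator (fun u => (1 + Real.cos (u / √(n : ℝ))) *
        (1 - 2 * p * (1 - Real.cos (u / √(n : ℝ)))) ^ n) u) atTop (𝓝 √(Real.pi / p)) := by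
    rw [← h_gauss]
    refine tendsto_integral_filter_of_dominated_convergence
      (fun u => (2 + Real.pi ^ 2 + Real.pi ^ 2 / (2 * p)) * (1 + u ^ 2)⁻¹) ?_ ?_ ?_ ?_
    · exact .of_forall fun n =>
        ((by fun_prop : Continuous _).stronglyMeasurable.indicator
          measurableSet_Iic).aestronglyMeasurable
    · filter_upwards [eventually_gt_atTop 0] with n hn
      filter_upwards [ae_restrict_mem measurableSet_Ioi] with u (hu : 0 < u)
      exact norm_indicator_one_add_cos_mul_pow_le hp₀ hp hn hu.le
    · exact (integrable_inv_one_add_sq.const_mul _).restrict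
    · filter_upwards with u
      refine (tendsto_one_add_cos_mul_pow p u).congr' ?_
      have h_top : Tendsto (fun n : ℕ => √(n : ℝ) * Real.pi) atTop atTop :=
        (Real.tendsto_sqrt_atTop.comp tendsto_natCast_atTop_atTop).atTop_mul_const Real.pi_pos
      filter_upwards [h_top.eventually_ge_atTop u] with n hn
      rw [Set.indicator_of_mem (show u ∈ Set.Iic (√(n : ℝ) * Real.pi) from hn)]
  refine h_lim.congr' ?_
  filter_upwards [eventually_gt_atTop 0] with n hn
  have hn' : (0 : ℝ) < n := by exact_mod_cast hn
  exact (mul_intervalIntegral_eq_integral_indicator_comp_div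
    (fun t => (1 + Real.cos t) * (1 - 2 * p * (1 - Real.cos t)) ^ n) Real.pi_pos.le
    (Real.sqrt_pos.2 hn')).symm

end Laplace

theorem tendsto_rpow_half_mul_of_survivalRecursion {p : ℝ} (hp₀ : 0 < p) (hp : p ≤ 1 / 2)
    {V : ℕ → ℕ → ℝ} (h_init : ∀ h, V 0 (h + 1) = 1) (h_bdry : ∀ n, V n 0 = 0)
    (h_step : ∀ n h, V (n + 1) (h + 1) =
      p * V n (h + 2) + p * V n h + (1 - 2 * p) * V n (h + 1)) :
    Tendsto (fun n : ℕ => (n : ℝ) ^ (1 / 2 : ℝ) * V n 1) atTop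
      (𝓝 (Real.pi⁻¹ * √(Real.pi / p))) := by
  refine ((tendsto_sqrt_mul_integral hp₀ hp).const_mul Real.pi⁻¹).congr fun n => ?_
  simp only [eq_integral_survivalKernel h_init h_bdry h_step n 1, survivalKernel,
    Finset.sum_range_one, Nat.cast_zero, zero_mul, Real.cos_zero, zero_add, Nat.cast_one, one_mul,
    Real.sqrt_eq_rpow]
  ring

/-- The law `ρ` on `ℕ` of the time at which a run of length `n` is completed, when runs are
repeated until one of them lasts for `n` steps and a run survives its first `k` steps with
probability `q k`: either the first run is completed, at time `n`, or it fails at its step `k + 1`,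
for some `k < n`, and everything starts over at time `k + 1`. -/
def IsRenewalLaw (q : ℕ → ℝ) (n : ℕ) (ρ : Measure ℕ) : Prop :=
  ρ = ENNReal.ofReal (q n) • Measure.dirac n +
    ∑ k ∈ Finset.range n, ENNReal.ofReal (q k - q (k + 1)) • ρ.map fun x => x + (k + 1)

namespace IsRenewalLaw

section Moments

variable {q : ℕ → ℝ} {n : ℕ} {ρ : Measure ℕ} (h : IsRenewalLaw q n ρ) (hq : IsSurvivalFunction q)
include h hq

theorem integral_eq {E : Type*} [NormedAddCommGroup E] [NormedSpace ℝ E] [CompleteSpace E]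
    {G : ℕ → E} (hG : ∀ d, Integrable (fun x => G (x + d)) ρ) :
    ∫ x, G x ∂ρ = q n • G n +
      ∑ k ∈ Finset.range n, (q k - q (k + 1)) • ∫ x, G (x + (k + 1)) ∂ρ := by
  have h_int (k : ℕ) :
      Integrable G (ENNReal.ofReal (q k - q (k + 1)) • ρ.map fun x => x + (k + 1)) := by
    refine Integrable.smul_measure ?_ ENNReal.ofReal_ne_top
    rw [integrable_map_measure AEStronglyMeasurable.of_discrete
      Measurable.of_discrete.aemeasurable]
    exact hG (k + 1)
  conv_lhs => rw [h]
  rw [integral_add_measure ((integrable_dirac (by simp)).smul_measure ENNReal.ofReal_ne_top)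
      (integrable_finsetSum_measure.2 fun k _ => h_int k), integral_smul_measure, integral_dirac,
    ENNReal.toReal_ofReal (hq.pos n).le, integral_finsetSum_measure fun k _ => h_int k]
  congr 1
  refine Finset.sum_congr rfl fun k _ => ?_
  rw [integral_smul_measure, ENNReal.toReal_ofReal (hq.sub_succ_nonneg k),
    integral_map Measurable.of_discrete.aemeasurable AEStronglyMeasurable.of_discrete]

theorem integral_le {G : ℕ → ℝ} (hG : ∀ d, Integrable (fun x => G (x + d)) ρ)
    {C : ℝ} (hC : ∀ d ≤ n, ∀ x, G (x + d) ≤ C * G x) :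
    ∫ x, G x ∂ρ ≤ q n * G n + (1 - q n) * (C * ∫ x, G x ∂ρ) := by
  calc ∫ x, G x ∂ρ
      = q n • G n + ∑ k ∈ Finset.range n, (q k - q (k + 1)) • ∫ x, G (x + (k + 1)) ∂ρ :=
        h.integral_eq hq hG
    _ ≤ q n * G n + ∑ k ∈ Finset.range n, (q k - q (k + 1)) * (C * ∫ x, G x ∂ρ) := by
        refine add_le_add le_rfl (Finset.sum_le_sum fun k hk => ?_)
        rw [smul_eq_mul, ← integral_const_mul C]
        exact mul_le_mul_of_nonneg_left (integral_mono (hG (k + 1)) ((hG 0).const_mul C)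
          (hC (k + 1) (Finset.mem_range.1 hk))) (hq.sub_succ_nonneg k)
    _ = q n * G n + (1 - q n) * (C * ∫ x, G x ∂ρ) := by
        rw [← Finset.sum_mul, hq.sum_sub_succ]

theorem ae_le [IsFiniteMeasure ρ] : ∀ᵐ x ∂ρ, n ≤ x := by
  have h_le : ρ.real (Set.Iio n) ≤ (1 - q n) * ρ.real (Set.Iio n) := by
    have h_bound (d : ℕ) : Integrable (fun x => (Set.Iio n).indicator (1 : ℕ → ℝ) (x + d)) ρ :=
      .of_bound AEStronglyMeasurable.of_discrete 1 (.of_forall fun x => by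
        simpa using norm_indicator_le_norm_self (s := Set.Iio n) (1 : ℕ → ℝ) (x + d))
    have h_shift (d : ℕ) (_ : d ≤ n) (x : ℕ) : (Set.Iio n).indicator (1 : ℕ → ℝ) (x + d) ≤
        1 * (Set.Iio n).indicator (1 : ℕ → ℝ) x := by
      simp only [Set.indicator_apply, Set.mem_Iio, Pi.one_apply]
      split_ifs <;> first | lia | norm_num
    simpa using h.integral_le hq h_bound h_shift
  have h_zero : ρ.real (Set.Iio n) = 0 := by
    nlinarith [measureReal_nonneg (μ := ρ) (s := Set.Iio n), hq.pos n]
  rw [measureReal_eq_zero_iff] at h_zero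
  rw [ae_iff]
  simpa [Set.Iio] using h_zero

theorem integral_indicator_pow_le [IsFiniteMeasure ρ] {z : ℝ} (hz : 1 ≤ z)
    (hzn : (1 - q n) * z ^ n < 1) (m : ℕ) :
    ∫ x, (Set.Iic m).indicator (z ^ ·) x ∂ρ ≤ q n * z ^ n / (1 - (1 - q n) * z ^ n) := by
  have hz₀ : 0 < z := one_pos.trans_le hz
  have h_bound (d : ℕ) : Integrable (fun x => (Set.Iic m).indicator (z ^ ·) (x + d)) ρ := by
    refine .of_bound AEStronglyMeasurable.of_discrete (z ^ m) (.of_forall fun x => ?_)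
    rw [norm_indicator_eq_indicator_norm]
    refine Set.indicator_apply_le' (fun hx => ?_) fun _ => by positivity
    rw [norm_pow, Real.norm_of_nonneg hz₀.le]
    exact pow_le_pow_right₀ hz hx
  have h_shift (d : ℕ) (hd : d ≤ n) (x : ℕ) : (Set.Iic m).indicator (z ^ ·) (x + d) ≤
      z ^ n * (Set.Iic m).indicator (z ^ ·) x := by
    by_cases hx : x + d ≤ m
    · rw [Set.indicator_of_mem (show x + d ∈ Set.Iic m from hx),
        Set.indicator_of_mem (show x ∈ Set.Iic m from le_of_add_le_left hx), pow_add, mul_comm]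
      gcongr
    · rw [Set.indicator_of_notMem (show x + d ∉ Set.Iic m from hx)]
      exact mul_nonneg (by positivity) (Set.indicator_nonneg (fun x _ => by positivity) x)
  have h_le := h.integral_le hq h_bound h_shift
  have h_ind : (Set.Iic m).indicator (z ^ ·) n ≤ z ^ n :=
    Set.indicator_le_self' (fun _ _ => by positivity) n
  rw [le_div_iff₀ (by linarith)]
  nlinarith [mul_le_mul_of_nonneg_left h_ind (hq.pos n).le]

theorem integrable_pow [IsFiniteMeasure ρ] (j : ℕ) :
    Integrable (fun x : ℕ => (x : ℝ) ^ j) ρ := by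
  obtain ⟨z, hz, hzn⟩ : ∃ z : ℝ, 1 < z ∧ (1 - q n) * z ^ n < 1 := by
    have h_tendsto : Tendsto (fun z : ℝ => (1 - q n) * z ^ n) (𝓝[>] 1) (𝓝 (1 - q n)) :=
      ((by fun_prop : Continuous fun z : ℝ => (1 - q n) * z ^ n).tendsto' 1 _ (by simp)).mono_left
        nhdsWithin_le_nhds
    exact (eventually_mem_nhdsWithin.and
      (h_tendsto.eventually_lt_const (sub_lt_self 1 (hq.pos n)))).exists
  have h_exp : Integrable (fun x : ℕ => z ^ x) ρ := by
    refine (aecover_Iic (α := ℕ) tendsto_id).integrable_of_integral_norm_bounded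
      (q n * z ^ n / (1 - (1 - q n) * z ^ n)) (fun m => ?_) (.of_forall fun m => ?_)
    · exact IntegrableOn.of_finite (Set.finite_Iic m)
    · refine le_of_eq_of_le ?_ (h.integral_indicator_pow_le hq hz.le hzn m)
      rw [integral_indicator measurableSet_Iic]
      simp only [norm_pow, Real.norm_of_nonneg (zero_le_one.trans hz.le), id]
  obtain ⟨C, -, hC⟩ := Asymptotics.bound_of_isBigO_nat_atTop
    (isLittleO_pow_const_const_pow_of_one_lt (R := ℝ) j hz).isBigO
  exact (h_exp.norm.const_mul C).mono' AEStronglyMeasurable.of_discrete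
    (.of_forall fun x => hC (pow_pos (one_pos.trans hz) x).ne')

theorem memLp_two [IsFiniteMeasure ρ] : MemLp (fun x : ℕ => (x : ℝ)) 2 ρ :=
  (memLp_two_iff_integrable_sq AEStronglyMeasurable.of_discrete).2 (h.integrable_pow hq 2)

variable [IsProbabilityMeasure ρ]

theorem integral_natCast :
    ∫ x : ℕ, (x : ℝ) ∂ρ = n * (1 + truncatedMoment q 1 n) := by
  have h_int : Integrable (fun x : ℕ => (x : ℝ)) ρ := by simpa using h.integrable_pow hq 1
  have h_shift (k : ℕ) : ∫ x : ℕ, ((x + k : ℕ) : ℝ) ∂ρ = (∫ x : ℕ, (x : ℝ) ∂ρ) + k := by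
    simp only [Nat.cast_add]
    rw [integral_add h_int (integrable_const _), integral_const, probReal_univ, one_smul]
  have h_eq := h.integral_eq hq (G := fun x : ℕ => (x : ℝ)) fun d => by
    simpa using h_int.add (integrable_const (d : ℝ))
  have h_moment := pow_mul_truncatedMoment q 1 n
  simp only [pow_one, eq_div_iff (hq.pos n).ne'] at h_moment
  have h_sum : ∑ k ∈ Finset.range n, (q k - q (k + 1)) * ((∫ x : ℕ, (x : ℝ) ∂ρ) + (k + 1)) =
      (1 - q n) * (∫ x : ℕ, (x : ℝ) ∂ρ) + n * truncatedMoment q 1 n * q n := by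
    simp only [mul_add _ (∫ x : ℕ, (x : ℝ) ∂ρ), Finset.sum_add_distrib, ← Finset.sum_mul,
      hq.sum_sub_succ, h_moment]
  simp only [h_shift, smul_eq_mul, Nat.cast_add_one, h_sum] at h_eq
  exact mul_left_cancel₀ (hq.pos n).ne' (by linear_combination h_eq)

theorem integral_natCast_sq : ∫ x : ℕ, (x : ℝ) ^ 2 ∂ρ = n ^ 2 * (1 + truncatedMoment q 2 n) +
    2 * n * truncatedMoment q 1 n * ∫ x : ℕ, (x : ℝ) ∂ρ := by
  have h_int : Integrable (fun x : ℕ => (x : ℝ)) ρ := by simpa using h.integrable_pow hq 1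
  have h_int_sq := h.integrable_pow hq 2
  have h_int_lin (d : ℕ) : Integrable (fun x : ℕ => (x : ℝ) ^ 2 + 2 * d * x) ρ :=
    h_int_sq.add (h_int.const_mul _)
  have h_int_shift (d : ℕ) : Integrable (fun x : ℕ => ((x + d : ℕ) : ℝ) ^ 2) ρ := by
    simp only [Nat.cast_add, add_sq, mul_right_comm]
    exact (h_int_lin d).add (integrable_const _)
  have h_shift (d : ℕ) : ∫ x : ℕ, ((x + d : ℕ) : ℝ) ^ 2 ∂ρ =
      (∫ x : ℕ, (x : ℝ) ^ 2 ∂ρ) + 2 * d * (∫ x : ℕ, (x : ℝ) ∂ρ) + d ^ 2 := by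
    calc ∫ x : ℕ, ((x + d : ℕ) : ℝ) ^ 2 ∂ρ
        = ∫ x : ℕ, (x : ℝ) ^ 2 + 2 * d * x + d ^ 2 ∂ρ := by
          simp only [Nat.cast_add, add_sq, mul_right_comm]
      _ = _ := by
          rw [integral_add (h_int_lin d) (integrable_const _),
            integral_add h_int_sq (h_int.const_mul _), integral_const_mul, integral_const,
            probReal_univ, one_smul]
  have h_eq := h.integral_eq hq (G := fun x : ℕ => (x : ℝ) ^ 2) h_int_shift
  have h_moment := pow_mul_truncatedMoment q 1 n
  have h_moment_sq := pow_mul_truncatedMoment q 2 n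
  simp only [pow_one, eq_div_iff (hq.pos n).ne'] at h_moment h_moment_sq
  have h_sum : ∑ k ∈ Finset.range n, (q k - q (k + 1)) * ((∫ x : ℕ, (x : ℝ) ^ 2 ∂ρ) +
      2 * (k + 1) * (∫ x : ℕ, (x : ℝ) ∂ρ) + (k + 1) ^ 2) =
      (1 - q n) * (∫ x : ℕ, (x : ℝ) ^ 2 ∂ρ) + n * truncatedMoment q 1 n * q n *
        (2 * ∫ x : ℕ, (x : ℝ) ∂ρ) + n ^ 2 * truncatedMoment q 2 n * q n := by
    rw [h_moment, h_moment_sq, ← hq.sum_sub_succ, Finset.sum_mul, Finset.sum_mul,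
      ← Finset.sum_add_distrib, ← Finset.sum_add_distrib]
    exact Finset.sum_congr rfl fun k _ => by ring
  simp only [h_shift, smul_eq_mul, Nat.cast_add_one, h_sum] at h_eq
  exact mul_left_cancel₀ (hq.pos n).ne' (by linear_combination h_eq)

theorem variance_natCast : variance (fun x : ℕ => (x : ℝ)) ρ =
    n ^ 2 * (truncatedMoment q 1 n ^ 2 + truncatedMoment q 2 n) := by
  rw [variance_eq_sub (h.memLp_two hq)]
  simp only [Pi.pow_apply]
  rw [h.integral_natCast_sq hq, h.integral_natCast hq]
  ring

theorem charFun_map_div_sub_one_mul (hn : n ≠ 0) (s : ℝ) :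
    charFun (ρ.map fun x : ℕ => (x : ℝ) / n - 1) s *
      (1 - momentSeries (truncatedMoment q · n) s) = 1 := by
  have hn' : (n : ℝ) ≠ 0 := Nat.cast_ne_zero.2 hn
  have hqn : (q n : ℂ) ≠ 0 := Complex.ofReal_ne_zero.2 (hq.pos n).ne'
  set G : ℕ → ℂ := fun x => Complex.exp (s * ((x : ℝ) / n - 1 : ℝ) * Complex.I) with hG
  have h_charFun : charFun (ρ.map fun x : ℕ => (x : ℝ) / n - 1) s = ∫ x, G x ∂ρ := by
    rw [charFun_apply_real, integral_map Measurable.of_discrete.aemeasurable (by fun_prop)]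
  have h_shift (x k : ℕ) :
      G (x + (k + 1)) = Complex.exp (Complex.I * s * (((k : ℝ) + 1) / n : ℝ)) * G x := by
    simp only [hG]
    rw [← Complex.exp_add]
    push_cast
    ring_nf
  have h_int (d : ℕ) : Integrable (fun x => G (x + d)) ρ :=
    .of_bound AEStronglyMeasurable.of_discrete 1 (.of_forall fun x => by
      simp only [hG, ← Complex.ofReal_mul, Complex.norm_exp_ofReal_mul_I, le_refl])
  have h_eq := h.integral_eq hq h_int
  have h_G : G n = 1 := by
    simp only [hG, div_self hn', sub_self, Complex.ofReal_zero, mul_zero, zero_mul,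
      Complex.exp_zero]
  have h_total : 1 - (q n : ℂ) = ∑ k ∈ Finset.range n, ((q k - q (k + 1) : ℝ) : ℂ) := by
    exact_mod_cast (hq.sum_sub_succ n).symm
  have h_sum : ∑ k ∈ Finset.range n, ((q k - q (k + 1) : ℝ) : ℂ) *
      (Complex.exp (Complex.I * s * (((k : ℝ) + 1) / n : ℝ)) * ∫ x, G x ∂ρ) =
      (∑ k ∈ Finset.range n, ((q k - q (k + 1) : ℝ) : ℂ) *
        (Complex.exp (Complex.I * s * (((k : ℝ) + 1) / n : ℝ)) - 1)) * (∫ x, G x ∂ρ) +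
        (1 - q n) * ∫ x, G x ∂ρ := by
    rw [h_total, Finset.sum_mul, Finset.sum_mul, ← Finset.sum_add_distrib]
    exact Finset.sum_congr rfl fun k _ => by ring
  simp only [h_shift, integral_const_mul, h_G, Complex.real_smul, mul_one, h_sum] at h_eq
  rw [h_charFun, momentSeries_truncatedMoment, mul_one_sub, ← mul_div_assoc, sub_eq_iff_eq_add,
    ← sub_eq_iff_eq_add', eq_div_iff hqn]
  linear_combination h_eq

end Moments

section Limits

variable {q : ℕ → ℝ} {α c : ℝ} {ρ : ℕ → Measure ℕ} [∀ n, IsProbabilityMeasure (ρ n)]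
  (h : ∀ n, IsRenewalLaw q n (ρ n)) (hq : IsSurvivalFunction q) (hα : α < 1) (hc : c ≠ 0)
  (hqc : Tendsto (fun n : ℕ => (n : ℝ) ^ α * q n) atTop (𝓝 c))
include h hq hα hc hqc

theorem isEquivalent_integral_natCast :
    (fun n => ∫ x : ℕ, (x : ℝ) ∂ρ n) ~[atTop] fun n : ℕ => (1 - α)⁻¹ * (n : ℝ) := by
  have hα' : 1 - α ≠ 0 := sub_ne_zero.2 hα.ne'
  have h_tendsto : Tendsto (fun n => 1 + truncatedMoment q 1 n) atTop (𝓝 (1 - α)⁻¹) := by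
    convert (tendsto_truncatedMoment hc hqc one_ne_zero (by simpa using hα)).const_add 1 using 2
    rw [Nat.cast_one]
    field_simp
    ring
  refine (((Asymptotics.isEquivalent_const_iff_tendsto (inv_ne_zero hα')).2 h_tendsto).mul
    (.refl (u := fun n : ℕ => (n : ℝ)))).congr_left (.of_forall fun n => ?_)
  exact (mul_comm _ _).trans ((h n).integral_natCast hq).symm

theorem isEquivalent_variance_natCast (hα₀ : α ≠ 0) :
    (fun n => variance (fun x : ℕ => (x : ℝ)) (ρ n)) ~[atTop]
      fun n : ℕ => α / ((1 - α) ^ 2 * (2 - α)) * (n : ℝ) ^ 2 := by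
  have hα₁ : 1 - α ≠ 0 := by linarith
  have hα₂ : 2 - α ≠ 0 := by linarith
  have h_tendsto : Tendsto (fun n => truncatedMoment q 1 n ^ 2 + truncatedMoment q 2 n) atTop
      (𝓝 (α / ((1 - α) ^ 2 * (2 - α)))) := by
    convert ((tendsto_truncatedMoment hc hqc one_ne_zero (by simpa using hα)).pow 2).add
      (tendsto_truncatedMoment hc hqc two_ne_zero (by norm_num; linarith)) using 2
    push_cast
    field_simp
    ring
  refine (((Asymptotics.isEquivalent_const_iff_tendsto (by positivity)).2 h_tendsto).mul
    (.refl (u := fun n : ℕ => (n : ℝ) ^ 2))).congr_left (.of_forall fun n => ?_)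
  exact (mul_comm _ _).trans ((h n).variance_natCast hq).symm

theorem tendsto_charFun_map_div_sub_one (s : ℝ) :
    Tendsto (fun n => charFun ((ρ n).map fun x : ℕ => (x : ℝ) / n - 1) s) atTop
      (𝓝 (darlingMandelbrotCharFun α s)) := by
  have h_lim : Tendsto (fun n => 1 - momentSeries (truncatedMoment q · n) s) atTop
      (𝓝 (1 - momentSeries (fun k => α / (k - α)) s)) :=
    (tendsto_momentSeries_truncatedMoment hq hα hc hqc s).const_sub 1
  have h_mul : ∀ᶠ n in atTop, charFun ((ρ n).map fun x : ℕ => (x : ℝ) / n - 1) s *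
      (1 - momentSeries (truncatedMoment q · n) s) = 1 :=
    (eventually_ne_atTop 0).mono fun n hn => (h n).charFun_map_div_sub_one_mul hq hn s
  have h_norm : ∀ᶠ n in atTop, 1 ≤ ‖1 - momentSeries (truncatedMoment q · n) s‖ := by
    filter_upwards [h_mul] with n hn
    have : IsProbabilityMeasure ((ρ n).map fun x : ℕ => (x : ℝ) / n - 1) :=
      Measure.isProbabilityMeasure_map Measurable.of_discrete.aemeasurable
    simpa only [← norm_mul, hn, norm_one] using
      mul_le_of_le_one_left (norm_nonneg (1 - momentSeries (truncatedMoment q · n) s))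
        (norm_charFun_le_one (μ := (ρ n).map fun x : ℕ => (x : ℝ) / n - 1) s)
  have h_ne : 1 - momentSeries (fun k => α / (k - α)) s ≠ 0 :=
    norm_pos_iff.1 (one_pos.trans_le (ge_of_tendsto h_lim.norm h_norm))
  rw [darlingMandelbrotCharFun_eq_momentSeries]
  exact (h_lim.inv₀ h_ne).congr' (h_mul.mono fun n hn => (eq_inv_of_mul_eq_one_left hn).symm)

end Limits

end IsRenewalLaw

section Weak

theorem exists_tendsto_of_tendsto_charFun {μ : ℕ → ProbabilityMeasure ℝ} {f : ℝ → ℂ}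
    (hf : ContinuousAt f 0)
    (h : ∀ t, Tendsto (fun n => charFun (μ n : Measure ℝ) t) atTop (𝓝 (f t))) :
    ∃ μ₀ : ProbabilityMeasure ℝ, (∀ t, charFun (μ₀ : Measure ℝ) t = f t) ∧
      Tendsto μ atTop (𝓝 μ₀) := by
  have h_tight : IsTightMeasureSet (Set.range fun n => (μ n : Measure ℝ)) :=
    isTightMeasureSet_of_tendsto_charFun hf h
  have h_compact : IsCompact (closure (Set.range μ)) := by
    refine isCompact_closure_of_isTightMeasureSet ?_
    convert h_tight using 1
    ext ρ
    simp
  obtain ⟨μ₀, -, hμ₀⟩ := h_compact.exists_mapClusterPt (f := atTop) (u := μ)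
    (tendsto_principal.2 (.of_forall fun n => subset_closure ⟨n, rfl⟩))
  have h_charFun (t : ℝ) : charFun (μ₀ : Measure ℝ) t = f t := by
    obtain ⟨u, hu, hu'⟩ := mapClusterPt_iff_ultrafilter.1 hμ₀
    refine tendsto_nhds_unique ?_ ((h t).mono_left hu)
    rw [ProbabilityMeasure.tendsto_iff_forall_integral_rclike_tendsto ℂ] at hu'
    simp_rw [charFun_eq_integral_innerProbChar]
    exact hu' _
  exact ⟨μ₀, h_charFun, ProbabilityMeasure.tendsto_of_tendsto_charFun fun t => h_charFun t ▸ h t⟩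

theorem measure_eq_zero_of_tendsto {ι E : Type*} [TopologicalSpace E] [MeasurableSpace E]
    [HasOuterApproxClosed E] [OpensMeasurableSpace E] {l : Filter ι} [l.NeBot]
    {μ : ι → ProbabilityMeasure E} {μ₀ : ProbabilityMeasure E} (h : Tendsto μ l (𝓝 μ₀)) {U : Set E}
    (hU : IsOpen U) (h_zero : ∀ᶠ i in l, (μ i : Measure E) U = 0) : (μ₀ : Measure E) U = 0 := by
  have h_le := ProbabilityMeasure.le_liminf_measure_open_of_tendsto h hU
  rwa [liminf_congr h_zero, liminf_const, nonpos_iff_eq_zero] at h_le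

end Weak

namespace IsRenewalLaw

theorem exists_tendsto_isDarlingMandelbrot {q : ℕ → ℝ} {α c : ℝ} {ρ : ℕ → Measure ℕ}
    [∀ n, IsProbabilityMeasure (ρ n)] (h : ∀ n, IsRenewalLaw q n (ρ n))
    (hq : IsSurvivalFunction q) (hα₀ : 0 ≤ α) (hα : α < 1) (hc : c ≠ 0)
    (hqc : Tendsto (fun n : ℕ => (n : ℝ) ^ α * q n) atTop (𝓝 c)) {κ : ℕ → ProbabilityMeasure ℝ}
    (hκ : ∀ n, (κ n : Measure ℝ) = (ρ n).map fun x : ℕ => (x : ℝ) / n - 1) :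
    ∃ μ : ProbabilityMeasure ℝ, IsDarlingMandelbrot α μ ∧ Tendsto κ atTop (𝓝 μ) := by
  obtain ⟨μ, hμ, h_lim⟩ := exists_tendsto_of_tendsto_charFun (μ := κ)
    (continuousAt_darlingMandelbrotCharFun hα₀ hα) fun t => by
      simpa only [hκ] using tendsto_charFun_map_div_sub_one h hq hα hc hqc t
  refine ⟨μ, ⟨measure_eq_zero_of_tendsto h_lim isOpen_Iio ?_, hμ⟩, h_lim⟩
  filter_upwards [eventually_gt_atTop 0] with n hn
  have hn' : (0 : ℝ) < n := by exact_mod_cast hn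
  rw [hκ, Measure.map_apply Measurable.of_discrete measurableSet_Iio]
  refine measure_mono_null (fun x (hx : (x : ℝ) / n - 1 < 0) => ?_) ((h n).ae_le hq)
  rw [sub_neg, div_lt_one hn', Nat.cast_lt] at hx
  exact not_le.2 hx

theorem exists_tendstoInDistribution {q : ℕ → ℝ} {α c : ℝ} {Ω : Type*} [MeasurableSpace Ω]
    {P : Measure Ω} [IsProbabilityMeasure P] {Z : ℕ → Ω → ℕ} (hZ : ∀ n, Measurable (Z n))
    (h : ∀ n, IsRenewalLaw q n (P.map (Z n)))
    (hq : IsSurvivalFunction q) (hα₀ : 0 ≤ α) (hα : α < 1) (hc : c ≠ 0)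
    (hqc : Tendsto (fun n : ℕ => (n : ℝ) ^ α * q n) atTop (𝓝 c)) :
    ∃ ν : ProbabilityMeasure ℝ, IsShiftedDarlingMandelbrot α ν ∧
      TendstoInDistribution (fun (n : ℕ) (ω : Ω) => (Z n ω : ℝ) / n) atTop (fun x : ℝ => x)
        (fun _ => P) (ν : Measure ℝ) := by
  have h_prob (n : ℕ) : IsProbabilityMeasure (P.map (Z n)) :=
    Measure.isProbabilityMeasure_map (hZ n).aemeasurable
  let κ (n : ℕ) : ProbabilityMeasure ℝ := ⟨(P.map (Z n)).map fun x : ℕ => (x : ℝ) / n - 1,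
    Measure.isProbabilityMeasure_map Measurable.of_discrete.aemeasurable⟩
  obtain ⟨μ, hμ, h_lim⟩ :=
    exists_tendsto_isDarlingMandelbrot (κ := κ) h hq hα₀ hα hc hqc fun _ => rfl
  have h_cont : Continuous fun x : ℝ => x + 1 := by fun_prop
  refine ⟨μ.map h_cont.measurable.aemeasurable, ⟨μ, hμ, rfl⟩,
    fun n => ((measurable_from_nat (f := fun x => (x : ℝ) / n)).comp (hZ n)).aemeasurable,
    aemeasurable_id', ?_⟩
  refine ((ProbabilityMeasure.tendsto_map_of_tendsto_of_continuous _ _ h_lim h_cont).congr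
    fun n => Subtype.ext ?_).trans_eq (congrArg 𝓝 (Subtype.ext Measure.map_id.symm))
  change ((P.map (Z n)).map fun x : ℕ => (x : ℝ) / n - 1).map (fun x => x + 1) =
    P.map fun ω => (Z n ω : ℝ) / n
  rw [Measure.map_map h_cont.measurable Measurable.of_discrete,
    Measure.map_map Measurable.of_discrete (hZ n)]
  congr 1
  ext ω
  simp

end IsRenewalLaw

/-- The walk with the steps `w 0, w 1, …`, started from the height `h`, stays nonnegative for `n`
steps. -/
def StaysNonneg (h : ℤ) (n : ℕ) (w : ℕ → MotzkinKind) : Prop :=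
  ∀ k ≤ n, 0 ≤ h + ∑ i ∈ Finset.range k, (w i).rise

/-- The sequence `w` without its first `m` terms: the steps that are still to come when the
algorithm starts over at time `m`. -/
def seqShift {S : Type*} (m : ℕ) (w : ℕ → S) : ℕ → S := fun i => w (m + i)

namespace StaysNonneg

theorem mono {h : ℤ} {m n : ℕ} {w : ℕ → MotzkinKind} (H : StaysNonneg h n w) (hmn : m ≤ n) :
    StaysNonneg h m w := fun k hk => H k (hk.trans hmn)

theorem nonneg {h : ℤ} {n : ℕ} {w : ℕ → MotzkinKind} (H : StaysNonneg h n w) : 0 ≤ h := by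
  simpa using H 0 n.zero_le

end StaysNonneg

theorem staysNonneg_zero_iff {h : ℤ} {w : ℕ → MotzkinKind} : StaysNonneg h 0 w ↔ 0 ≤ h := by
  simp [StaysNonneg]

theorem staysNonneg_succ_iff_seqShift {h : ℤ} (hh : 0 ≤ h) {n : ℕ} {w : ℕ → MotzkinKind} :
    StaysNonneg h (n + 1) w ↔ StaysNonneg (h + (w 0).rise) n (seqShift 1 w) := by
  have h_sum (k : ℕ) : h + ∑ i ∈ Finset.range (k + 1), (w i).rise =
      h + (w 0).rise + ∑ i ∈ Finset.range k, (seqShift 1 w i).rise := by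
    rw [Finset.sum_range_succ', add_comm (Finset.sum _ _), ← add_assoc]
    simp only [seqShift, add_comm 1]
  refine ⟨fun H k hk => h_sum k ▸ H (k + 1) (Nat.succ_le_succ hk), ?_⟩
  rintro H (_ | k) hk
  · simpa using hh
  · exact h_sum k ▸ H k (Nat.le_of_succ_le_succ hk)

theorem staysNonneg_succ_iff_last {h : ℤ} {n : ℕ} {w : ℕ → MotzkinKind} :
    StaysNonneg h (n + 1) w ↔
      StaysNonneg h n w ∧ 0 ≤ h + ∑ i ∈ Finset.range (n + 1), (w i).rise := by
  simp only [StaysNonneg, Nat.le_succ_iff, or_imp, forall_and, forall_eq]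

theorem dependsOn_staysNonneg (h : ℤ) (n : ℕ) : DependsOn (StaysNonneg h n) (Set.Iio n) := by
  refine fun w w' hw => propext (forall₂_congr fun k hk => ?_)
  rw [Finset.sum_congr rfl fun i hi => by rw [hw i ((Finset.mem_range.1 hi).trans_le hk)]]

section Florentine

variable {S : Type*} {kind : S → MotzkinKind} {w : ℕ → S} {k m n : ℕ}

theorem pathHeight_map_range :
    pathHeight kind ((List.range m).map w) = ∑ i ∈ Finset.range m, (kind (w i)).rise := by
  induction m with
  | zero => rfl
  | succ m ih =>
    rw [Finset.sum_range_succ, ← ih]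
    simp [pathHeight, List.range_succ]

theorem map_florentinePath :
    (florentinePath kind w m).map kind = florentinePath id (kind ∘ w) m := by
  have h_height (p : List S) : pathHeight id (p.map kind) = pathHeight kind p := by
    simp only [pathHeight, List.map_map, Function.comp_def, id]
  induction m with
  | zero => rfl
  | succ m ih =>
    simp only [florentinePath, ← ih, Function.comp_apply, ← List.map_singleton (f := kind),
      ← List.map_append, h_height, apply_ite (List.map kind), List.map_nil]

theorem length_florentinePath_comp :
    (florentinePath id (kind ∘ w) m).length = (florentinePath kind w m).length := by
  rw [← map_florentinePath, List.length_map]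

theorem florentineTerminates_comp_iff :
    FlorentineTerminates id (kind ∘ w) n ↔ FlorentineTerminates kind w n := by
  simp only [FlorentineTerminates, length_florentinePath_comp]

theorem florentineCost_comp : florentineCost id (kind ∘ w) n = florentineCost kind w n := by
  simp only [florentineCost, length_florentinePath_comp]

theorem florentinePath_eq_map_range (H : StaysNonneg 0 n (kind ∘ w)) (hm : m ≤ n) :
    florentinePath kind w m = (List.range m).map w := by
  induction m with
  | zero => rfl
  | succ m ih =>
    have h_append : (List.range m).map w ++ [w m] = (List.range (m + 1)).map w := by
      rw [List.range_succ, List.map_append, List.map_singleton]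
    rw [florentinePath, ih (Nat.le_of_succ_le hm), h_append, pathHeight_map_range, if_pos]
    simpa using H (m + 1) hm

theorem length_florentinePath (H : StaysNonneg 0 n (kind ∘ w)) (hm : m ≤ n) :
    (florentinePath kind w m).length = m := by
  rw [florentinePath_eq_map_range H hm, List.length_map, List.length_range]

theorem florentinePath_succ_eq_nil (H : StaysNonneg 0 k (kind ∘ w))
    (H' : ¬ StaysNonneg 0 (k + 1) (kind ∘ w)) : florentinePath kind w (k + 1) = [] := by
  have h_append : (List.range k).map w ++ [w k] = (List.range (k + 1)).map w := by
    rw [List.range_succ, List.map_append, List.map_singleton]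
  rw [florentinePath, florentinePath_eq_map_range H le_rfl, h_append, pathHeight_map_range, if_neg]
  exact fun h => H' (staysNonneg_succ_iff_last.2 ⟨H, by simpa using h⟩)

theorem florentinePath_add (h : florentinePath kind w m = []) (j : ℕ) :
    florentinePath kind w (j + m) = florentinePath kind (seqShift m w) j := by
  induction j with
  | zero => rw [zero_add, h, florentinePath]
  | succ j ih =>
    rw [Nat.succ_add_eq_add_succ, Nat.add_succ, florentinePath, ih, florentinePath, seqShift,
      add_comm m j]

theorem dependsOn_florentinePath (kind : S → MotzkinKind) (m : ℕ) :
    DependsOn (florentinePath kind · m) (Set.Iio m) := by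
  intro w w' hw
  induction m with
  | zero => rfl
  | succ m ih =>
    simp only [florentinePath, ih fun i hi => hw i (Nat.lt_succ_of_lt hi), hw m m.lt_succ_self]

theorem florentineTerminates_of_staysNonneg (H : StaysNonneg 0 n (kind ∘ w)) :
    FlorentineTerminates kind w n := ⟨n, length_florentinePath H le_rfl⟩

theorem florentineCost_of_staysNonneg (H : StaysNonneg 0 n (kind ∘ w)) :
    florentineCost kind w n = n := by
  have h_mem : n ∈ {m | (florentinePath kind w m).length = n} := length_florentinePath H le_rfl
  refine (Nat.sInf_le h_mem).antisymm (le_csInf ⟨n, h_mem⟩ fun m (hm : _ = n) => ?_)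
  by_contra! h_lt
  exact h_lt.ne (length_florentinePath H h_lt.le ▸ hm)

theorem succ_le_of_length_florentinePath_eq (hk : k < n) (H : StaysNonneg 0 k (kind ∘ w))
    (hm : (florentinePath kind w m).length = n) : k + 1 ≤ m := by
  by_contra! h_lt
  rw [length_florentinePath H (Nat.le_of_lt_succ h_lt)] at hm
  lia

theorem florentineTerminates_iff_seqShift (hk : k < n) (H : StaysNonneg 0 k (kind ∘ w))
    (H' : ¬ StaysNonneg 0 (k + 1) (kind ∘ w)) :
    FlorentineTerminates kind w n ↔ FlorentineTerminates kind (seqShift (k + 1) w) n := by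
  have h_add := florentinePath_add (florentinePath_succ_eq_nil H H')
  refine ⟨fun ⟨m, hm⟩ => ⟨m - (k + 1), ?_⟩, fun ⟨m, hm⟩ => ⟨m + (k + 1), by rw [h_add, hm]⟩⟩
  rw [← h_add, Nat.sub_add_cancel (succ_le_of_length_florentinePath_eq hk H hm), hm]

theorem florentineCost_eq_seqShift_add (hk : k < n) (H : StaysNonneg 0 k (kind ∘ w))
    (H' : ¬ StaysNonneg 0 (k + 1) (kind ∘ w)) (h_term : FlorentineTerminates kind w n) :
    florentineCost kind w n = florentineCost kind (seqShift (k + 1) w) n + (k + 1) := by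
  have h_le : k + 1 ≤ sInf {m | (florentinePath kind w m).length = n} :=
    le_csInf h_term fun m hm => succ_le_of_length_florentinePath_eq hk H hm
  rw [florentineCost, florentineCost, ← Nat.sInf_add h_le]
  simp only [florentinePath_add (florentinePath_succ_eq_nil H H')]

end Florentine

section Measurability

variable {ι S : Type*} [MeasurableSpace S]

theorem measurableSet_cylinderEvents_of_dependsOn [Countable S] [MeasurableSingletonClass S]
    {Δ : Set ι} [Finite Δ] {A : Set (ι → S)} (hA : DependsOn (· ∈ A) Δ) :
    MeasurableSet[cylinderEvents Δ] A := by
  have h_preimage : A = Δ.domRestrict ⁻¹' (Δ.domRestrict '' A) := by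
    refine (Set.subset_preimage_image _ A).antisymm ?_
    rintro w ⟨w', hw', h_eq⟩
    exact (hA fun i hi => congr_fun h_eq ⟨i, hi⟩).mp hw'
  rw [h_preimage]
  exact measurable_restrict_cylinderEvents Δ (Set.to_countable _).measurableSet

theorem measurableSet_of_dependsOn [Countable S] [MeasurableSingletonClass S]
    {Δ : Set ι} [Finite Δ] {A : Set (ι → S)} (hA : DependsOn (· ∈ A) Δ) : MeasurableSet A :=
  cylinderEvents_le_pi A (measurableSet_cylinderEvents_of_dependsOn hA)

theorem measurable_sInf_ofPred_mem {X : Type*} [MeasurableSpace X] {E : ℕ → Set X}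
    (hE : ∀ m, MeasurableSet (E m)) : Measurable fun x => sInf {m | x ∈ E m} := by
  refine measurable_of_Ici fun k => ?_
  cases k with
  | zero => simp
  | succ k =>
    have h_preimage : (fun x => sInf {m | x ∈ E m}) ⁻¹' Set.Ici (k + 1) =
        (⋃ m, E m) ∩ ⋂ m ∈ Set.Iic k, (E m)ᶜ := by
      ext x
      simp only [Set.mem_preimage, Set.mem_Ici, Set.mem_inter_iff, Set.mem_iUnion, Set.mem_iInter,
        Set.mem_Iic, Set.mem_compl_iff]
      refine ⟨fun h => ⟨Nat.nonempty_of_pos_sInf (k.succ_pos.trans_le h), fun m hm =>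
        Nat.notMem_of_lt_sInf ((Nat.lt_succ_of_le hm).trans_le h)⟩, fun ⟨h, h'⟩ =>
        le_csInf h fun m hm => ?_⟩
      by_contra! h_lt
      exact h' m (Nat.le_of_lt_succ h_lt) hm
    rw [h_preimage]
    exact (MeasurableSet.iUnion hE).inter
      (MeasurableSet.biInter (Set.to_countable _) fun m _ => (hE m).compl)

theorem measurable_seqShift (m : ℕ) : Measurable (seqShift m : (ℕ → S) → ℕ → S) :=
  measurable_pi_lambda _ fun i => measurable_pi_apply (m + i)

variable (ν : Measure S) [IsProbabilityMeasure ν]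

theorem infinitePi_inter_preimage_seqShift {m : ℕ} {A B : Set (ℕ → S)}
    (hA : MeasurableSet[cylinderEvents (Set.Iio m)] A) (hB : MeasurableSet B) :
    Measure.infinitePi (fun _ : ℕ => ν) (A ∩ seqShift m ⁻¹' B) =
      Measure.infinitePi (fun _ : ℕ => ν) A * Measure.infinitePi (fun _ : ℕ => ν) B := by
  have h_indep : Indep (cylinderEvents (Set.Iio m)) (cylinderEvents (Set.Ici m))
      (Measure.infinitePi fun _ : ℕ => ν) :=
    indep_iSup_of_disjoint (fun i => (measurable_pi_apply i).comap_le)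
      (iIndepFun_infinitePi (P := fun _ : ℕ => ν) (X := fun _ => id) fun _ => measurable_id)
      (Set.Iio_disjoint_Ici le_rfl)
  have h_shift : Measurable[cylinderEvents (Set.Ici m)] (seqShift (S := S) m) :=
    @measurable_pi_lambda _ _ _ (_) _ _ fun i =>
      measurable_cylinderEvent_apply (Nat.le_add_right m i)
  have h_law : (Measure.infinitePi fun _ : ℕ => ν).map (seqShift m) =
      Measure.infinitePi fun _ : ℕ => ν :=
    Measure.map_infinitePi_infinitePi_of_inj (add_right_injective m)
  rw [(Indep_iff _ _ _).1 h_indep A _ hA (h_shift hB),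
    ← Measure.map_apply (measurable_seqShift m) hB, h_law]

theorem infinitePi_real_eq_sum_seqShift [Fintype S] [MeasurableSingletonClass S]
    {A : Set (ℕ → S)} {B : S → Set (ℕ → S)} (hB : ∀ s, MeasurableSet (B s))
    (h : ∀ w, w ∈ A ↔ seqShift 1 w ∈ B (w 0)) :
    (Measure.infinitePi fun _ : ℕ => ν).real A =
      ∑ s, ν.real {s} * (Measure.infinitePi fun _ : ℕ => ν).real (B s) := by
  set μ := Measure.infinitePi fun _ : ℕ => ν with hμ
  have h_union : A = ⋃ s ∈ Finset.univ, (Function.eval 0 ⁻¹' {s} ∩ seqShift 1 ⁻¹' B s) := by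
    ext w
    simp [h]
  have h_first (s : S) : μ.real (Function.eval 0 ⁻¹' {s}) = ν.real {s} := by
    rw [← map_measureReal_apply (measurable_pi_apply 0) (measurableSet_singleton s), hμ,
      Measure.infinitePi_map_eval (fun _ : ℕ => ν) 0]
  have h_cylinder (s : S) : MeasurableSet[cylinderEvents (Set.Iio 1)]
      (Function.eval (0 : ℕ) ⁻¹' {s} : Set (ℕ → S)) :=
    measurable_cylinderEvent_apply (Set.mem_Iio.2 one_pos) (measurableSet_singleton s)
  rw [h_union, measureReal_biUnion_finset]
  · refine Finset.sum_congr rfl fun s _ => ?_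
    rw [measureReal_def, infinitePi_inter_preimage_seqShift ν (h_cylinder s) (hB s),
      ENNReal.toReal_mul, ← measureReal_def, h_first]
    rfl
  · intro s _ s' _ hne
    exact Set.disjoint_left.2 fun w hw hw' => hne (hw.1.symm.trans hw'.1)
  · exact fun s _ => (cylinderEvents_le_pi _ (h_cylinder s)).inter (measurable_seqShift 1 (hB s))

end Measurability

section FirstPassage

instance : MeasurableSpace MotzkinKind := ⊤

instance : DiscreteMeasurableSpace MotzkinKind := ⟨fun _ => trivial⟩

instance : Fintype MotzkinKind := ⟨{.up, .down, .level}, fun s => by cases s <;> decide⟩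

theorem measurableSet_staysNonneg (h : ℤ) (n : ℕ) : MeasurableSet {w | StaysNonneg h n w} :=
  measurableSet_of_dependsOn (dependsOn_staysNonneg h n)

/-- The sequences of steps for which the walk from the origin first becomes negative at step
`k + 1`, so that a run of the algorithm fails after drawing `k + 1` steps. -/
def failSet (k : ℕ) : Set (ℕ → MotzkinKind) :=
  {w | StaysNonneg 0 k w} \ {w | StaysNonneg 0 (k + 1) w}

theorem measurableSet_cylinderEvents_failSet (k : ℕ) :
    MeasurableSet[cylinderEvents (Set.Iio (k + 1))] (failSet k) := by
  have h_dep {m : ℕ} (hm : m ≤ k + 1) :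
      MeasurableSet[cylinderEvents (Set.Iio (k + 1))] {w | StaysNonneg 0 m w} :=
    cylinderEvents_mono (Set.Iio_subset_Iio hm) _
      (measurableSet_cylinderEvents_of_dependsOn (dependsOn_staysNonneg 0 m))
  exact (h_dep k.le_succ).diff (h_dep le_rfl)

theorem measure_eq_add_sum_failSet (μ : Measure (ℕ → MotzkinKind)) (E : Set (ℕ → MotzkinKind))
    (n : ℕ) :
    μ E = μ (E ∩ {w | StaysNonneg 0 n w}) + ∑ k ∈ Finset.range n, μ (E ∩ failSet k) := by
  induction n with
  | zero => simp [staysNonneg_zero_iff]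
  | succ n ih =>
    have h_anti : {w | StaysNonneg 0 (n + 1) w} ⊆ {w | StaysNonneg 0 n w} :=
      fun w hw => hw.mono n.le_succ
    rw [ih, ← measure_inter_add_sdiff (E ∩ {w | StaysNonneg 0 n w})
      (measurableSet_staysNonneg 0 (n + 1)), Set.inter_assoc, Set.inter_eq_right.2 h_anti,
      Set.inter_sdiff_assoc, Finset.sum_range_succ, ← failSet]
    ring

/-- The probability that the walk with i.i.d. steps of law `ν`, started from the height `h`, stays
nonnegative for `n` steps. -/
noncomputable def survivalProb (ν : Measure MotzkinKind) (n : ℕ) (h : ℤ) : ℝ :=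
  (Measure.infinitePi fun _ : ℕ => ν).real {w | StaysNonneg h n w}

theorem survivalProb_of_neg {ν : Measure MotzkinKind} (n : ℕ) {h : ℤ} (hh : h < 0) :
    survivalProb ν n h = 0 := by
  have h_empty : {w | StaysNonneg h n w} = ∅ :=
    Set.eq_empty_of_forall_notMem fun w hw => hw.nonneg.not_gt hh
  rw [survivalProb, h_empty, measureReal_empty]

variable {ν : Measure MotzkinKind} [IsProbabilityMeasure ν]

theorem survivalProb_zero {h : ℤ} (hh : 0 ≤ h) : survivalProb ν 0 h = 1 := by
  simp [survivalProb, staysNonneg_zero_iff, hh]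

theorem antitone_survivalProb (h : ℤ) : Antitone fun n => survivalProb ν n h :=
  fun _ _ hmn => measureReal_mono fun _ hw => hw.mono hmn

theorem measure_failSet (k : ℕ) : Measure.infinitePi (fun _ : ℕ => ν) (failSet k) =
    ENNReal.ofReal (survivalProb ν k 0 - survivalProb ν (k + 1) 0) := by
  have h_anti : {w | StaysNonneg 0 (k + 1) w} ⊆ {w | StaysNonneg 0 k w} :=
    fun w hw => hw.mono k.le_succ
  rw [survivalProb, survivalProb, ← measureReal_sdiff h_anti
    (measurableSet_staysNonneg 0 (k + 1)), ← failSet, ofReal_measureReal]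

theorem infinitePi_eq_add_sum_of_ae_seqShift {n : ℕ} {E : Set (ℕ → MotzkinKind)}
    {E' : ℕ → Set (ℕ → MotzkinKind)} (hE' : ∀ k, MeasurableSet (E' k))
    (h : ∀ k < n, ∀ᵐ w ∂Measure.infinitePi fun _ : ℕ => ν,
      w ∈ failSet k → (w ∈ E ↔ seqShift (k + 1) w ∈ E' k)) :
    Measure.infinitePi (fun _ : ℕ => ν) E =
      Measure.infinitePi (fun _ : ℕ => ν) (E ∩ {w | StaysNonneg 0 n w}) +
      ∑ k ∈ Finset.range n, ENNReal.ofReal (survivalProb ν k 0 - survivalProb ν (k + 1) 0) *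
        Measure.infinitePi (fun _ : ℕ => ν) (E' k) := by
  rw [measure_eq_add_sum_failSet _ E n]
  congr 1
  refine Finset.sum_congr rfl fun k hk => ?_
  rw [← measure_failSet,
    ← infinitePi_inter_preimage_seqShift ν (measurableSet_cylinderEvents_failSet k) (hE' k),
    Set.inter_comm]
  refine measure_congr ?_
  filter_upwards [h k (Finset.mem_range.1 hk)] with w hw
  exact propext (and_congr_right hw)

section SymmetricStep

variable {p : ℝ} (h_up : ν.real {.up} = p) (h_down : ν.real {.down} = p)
include h_up h_down

theorem real_level : ν.real {.level} = 1 - 2 * p := by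
  have h_total : ∑ s, ν.real {s} = 1 := by
    rw [sum_measureReal_singleton, Finset.coe_univ, probReal_univ]
  have h_expand : ∑ s, ν.real {s} = ν.real {.up} + (ν.real {.down} + ν.real {.level}) := by
    simp [Finset.univ, Fintype.elems, Finset.sum_insert]
  linarith

theorem survivalProb_succ (n : ℕ) {h : ℤ} (hh : 0 ≤ h) :
    survivalProb ν (n + 1) h = p * survivalProb ν n (h + 1) + p * survivalProb ν n (h - 1) +
      (1 - 2 * p) * survivalProb ν n h := by
  rw [survivalProb, infinitePi_real_eq_sum_seqShift ν (A := {w | StaysNonneg h (n + 1) w})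
    (B := fun s => {w | StaysNonneg (h + s.rise) n w})
    (fun s => measurableSet_staysNonneg (h + s.rise) n) fun w => staysNonneg_succ_iff_seqShift hh]
  simp only [Finset.univ, Fintype.elems]
  simp [Finset.sum_insert, h_up, h_down, real_level h_up h_down, MotzkinKind.rise, survivalProb,
    ← sub_eq_add_neg, add_assoc]

theorem survivalProb_pos (hp : 0 < p) (n : ℕ) {h : ℤ} (hh : 0 ≤ h) : 0 < survivalProb ν n h := by
  induction n generalizing h with
  | zero => simp [survivalProb_zero hh]
  | succ n ih =>
    have h_level : 0 ≤ 1 - 2 * p := real_level h_up h_down ▸ measureReal_nonneg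
    have h_down_nonneg : 0 ≤ survivalProb ν n (h - 1) := measureReal_nonneg
    have := ih (h := h + 1) (by lia)
    have := ih hh
    rw [survivalProb_succ h_up h_down n hh]
    positivity

theorem isSurvivalFunction_survivalProb (hp : 0 < p) :
    IsSurvivalFunction fun n => survivalProb ν n 0 where
  map_zero := survivalProb_zero le_rfl
  antitone := antitone_survivalProb 0
  pos n := survivalProb_pos h_up h_down hp n le_rfl

theorem tendsto_rpow_half_mul_survivalProb (hp : 0 < p) :
    Tendsto (fun n : ℕ => (n : ℝ) ^ (1 / 2 : ℝ) * survivalProb ν n 0) atTop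
      (𝓝 (Real.pi⁻¹ * √(Real.pi / p))) := by
  have h_level : 0 ≤ 1 - 2 * p := real_level h_up h_down ▸ measureReal_nonneg
  have h_init (h : ℕ) : survivalProb ν 0 ((h + 1 : ℕ) - 1) = 1 := survivalProb_zero (by simp)
  have h_bdry (n : ℕ) : survivalProb ν n ((0 : ℕ) - 1) = 0 := survivalProb_of_neg n (by simp)
  have h_step (n h : ℕ) : survivalProb ν (n + 1) ((h + 1 : ℕ) - 1) =
      p * survivalProb ν n ((h + 2 : ℕ) - 1) + p * survivalProb ν n ((h : ℕ) - 1) +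
        (1 - 2 * p) * survivalProb ν n ((h + 1 : ℕ) - 1) := by
    have h_two : ((h + 2 : ℕ) : ℤ) - 1 = h + 1 := by push_cast; ring
    rw [h_two, Nat.cast_succ, add_sub_cancel_right, survivalProb_succ h_up h_down n h.cast_nonneg]
  simpa using tendsto_rpow_half_mul_of_survivalRecursion hp (by linarith)
    (V := fun n h => survivalProb ν n (h - 1)) h_init h_bdry h_step

end SymmetricStep

end FirstPassage

section Cost

theorem measurableSet_length_florentinePath (m n : ℕ) :
    MeasurableSet {w : ℕ → MotzkinKind | (florentinePath id w m).length = n} :=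
  measurableSet_of_dependsOn fun _ _ hw =>
    congrArg (fun p => List.length p = n) (dependsOn_florentinePath id m hw)

theorem measurableSet_florentineTerminates (n : ℕ) :
    MeasurableSet {w | FlorentineTerminates id w n} := by
  simp only [FlorentineTerminates, Set.ofPred_exists]
  exact MeasurableSet.iUnion fun m => measurableSet_length_florentinePath m n

theorem measurable_florentineCost (n : ℕ) : Measurable fun w => florentineCost id w n :=
  measurable_sInf_ofPred_mem fun m => measurableSet_length_florentinePath m n

variable {ν : Measure MotzkinKind} [IsProbabilityMeasure ν]
  (hq : IsSurvivalFunction fun n => survivalProb ν n 0)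
include hq

theorem ae_florentineTerminates (n : ℕ) :
    ∀ᵐ w ∂Measure.infinitePi fun _ : ℕ => ν, FlorentineTerminates id w n := by
  set μ := Measure.infinitePi fun _ : ℕ => ν with hμ
  set N : Set (ℕ → MotzkinKind) := {w | ¬ FlorentineTerminates id w n}
  have h_empty : N ∩ {w | StaysNonneg 0 n w} = ∅ :=
    Set.eq_empty_of_forall_notMem fun w hw => hw.1 (florentineTerminates_of_staysNonneg hw.2)
  have h_renewal : μ N = ENNReal.ofReal (1 - survivalProb ν n 0) * μ N := by
    conv_lhs => rw [hμ, infinitePi_eq_add_sum_of_ae_seqShift (E := N) (E' := fun _ => N)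
      (fun _ => (measurableSet_florentineTerminates n).compl) fun k hk => .of_forall fun w hw =>
        not_congr (florentineTerminates_iff_seqShift (kind := id) hk hw.1 hw.2)]
    rw [h_empty, measure_empty, zero_add, ← Finset.sum_mul,
      ← ENNReal.ofReal_sum_of_nonneg fun k _ => hq.sub_succ_nonneg k, hq.sum_sub_succ]
  have h_lt : ENNReal.ofReal (1 - survivalProb ν n 0) < 1 :=
    ENNReal.ofReal_lt_one.2 (sub_lt_self 1 (hq.pos n))
  by_contra h_pos
  have h_strict : ENNReal.ofReal (1 - survivalProb ν n 0) * μ N < 1 * μ N :=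
    ENNReal.mul_lt_mul_left h_pos (measure_ne_top μ N) h_lt
  exact h_strict.ne (by rw [one_mul, ← h_renewal])

theorem isRenewalLaw_map_florentineCost (n : ℕ) :
    IsRenewalLaw (fun n => survivalProb ν n 0) n
      ((Measure.infinitePi fun _ : ℕ => ν).map fun w => florentineCost id w n) := by
  have h_meas := measurable_florentineCost n
  ext B hB
  have h_shift (k : ℕ) : MeasurableSet ((fun x => x + (k + 1)) ⁻¹' B) := .of_discrete
  rw [Measure.map_apply h_meas hB, infinitePi_eq_add_sum_of_ae_seqShift
    (E' := fun k => (fun w => florentineCost id w n) ⁻¹' ((fun x => x + (k + 1)) ⁻¹' B))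
    fun k => h_meas (h_shift k)]
  · rw [Measure.add_apply, Measure.finsetSum_apply]
    congr 1
    · have h_success : (fun w => florentineCost id w n) ⁻¹' B ∩ {w | StaysNonneg 0 n w} =
          {w | n ∈ B ∧ StaysNonneg 0 n w} :=
        Set.ext fun w => and_congr_left fun hw : StaysNonneg 0 n w => by
          rw [Set.mem_preimage, florentineCost_of_staysNonneg (kind := id) hw]
      rw [h_success, Measure.smul_apply, smul_eq_mul, Measure.dirac_apply' n hB]
      by_cases hn : n ∈ B <;> simp [hn, survivalProb]
    · refine Finset.sum_congr rfl fun k _ => ?_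
      rw [Measure.smul_apply, smul_eq_mul, Measure.map_apply .of_discrete hB,
        Measure.map_apply h_meas (h_shift k)]
  · intro k hk
    filter_upwards [ae_florentineTerminates hq n] with w h_term hw
    simp only [Set.mem_preimage, florentineCost_eq_seqShift_add (kind := id) hk hw.1 hw.2 h_term]

end Cost

section StepLaw

theorem measure_eq_of_real_up_down {ν ν' : Measure MotzkinKind} [IsProbabilityMeasure ν]
    [IsProbabilityMeasure ν'] {p : ℝ} (h_up : ν.real {.up} = p) (h_down : ν.real {.down} = p)
    (h_up' : ν'.real {.up} = p) (h_down' : ν'.real {.down} = p) : ν = ν' := by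
  refine Measure.ext_of_measureReal_singleton fun s => ?_
  cases s with
  | up => rw [h_up, h_up']
  | down => rw [h_down, h_down']
  | level => rw [real_level h_up h_down, real_level h_up' h_down']

variable {Ω : Type*} [MeasurableSpace Ω] {P : Measure Ω} [IsProbabilityMeasure P]

theorem exists_map_eq_infinitePi {X : ℕ → Ω → MotzkinKind} (h_meas : ∀ i, Measurable (X i))
    (h_indep : iIndepFun X P) {p : ℝ} (h_up : ∀ i, P.real {ω | X i ω = .up} = p)
    (h_down : ∀ i, P.real {ω | X i ω = .down} = p) :
    ∃ ν, IsProbabilityMeasure ν ∧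
      P.map (fun ω i => X i ω) = (Measure.infinitePi fun _ : ℕ => ν) ∧
      ν.real {.up} = p ∧ ν.real {.down} = p := by
  have h_prob (i : ℕ) : IsProbabilityMeasure (P.map (X i)) :=
    Measure.isProbabilityMeasure_map (h_meas i).aemeasurable
  have h_real (i : ℕ) (s : MotzkinKind) : (P.map (X i)).real {s} = P.real {ω | X i ω = s} :=
    map_measureReal_apply (h_meas i) (measurableSet_singleton s)
  have h_up' (i : ℕ) := (h_real i .up).trans (h_up i)
  have h_down' (i : ℕ) := (h_real i .down).trans (h_down i)
  refine ⟨P.map (X 0), h_prob 0, ?_, h_up' 0, h_down' 0⟩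
  rw [(iIndepFun_iff_map_fun_eq_infinitePi_map h_meas).1 h_indep]
  exact congrArg Measure.infinitePi (funext fun i =>
    measure_eq_of_real_up_down (h_up' i) (h_down' i) (h_up' 0) (h_down' 0))

theorem measureReal_of_uniform {S : Type*} [Fintype S] [MeasurableSpace S]
    [MeasurableSingletonClass S] {X : Ω → S} (hX : Measurable X)
    (h_unif : ∀ s, P {ω | X ω = s} = (Fintype.card S : ℝ≥0∞)⁻¹) (A : S → Prop)
    [DecidablePred A] :
    P.real {ω | A (X ω)} = Fintype.card {s // A s} / Fintype.card S := by
  have h_map : {ω | A (X ω)} = X ⁻¹' (Finset.univ.filter A : Finset S) := by ext ω; simp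
  have h_single (s : S) : (P.map X).real {s} = (Fintype.card S : ℝ)⁻¹ := by
    rw [map_measureReal_apply hX (measurableSet_singleton s)]
    exact (congrArg ENNReal.toReal (h_unif s)).trans (by simp)
  rw [h_map, ← map_measureReal_apply hX (Finset.measurableSet _), ← sum_measureReal_singleton]
  simp [h_single, Fintype.card_subtype, div_eq_mul_inv]

end StepLaw

theorem proposition1_general {S : Type*} (kind : S → MotzkinKind)
    {Ω : Type*} [MeasurableSpace Ω] (P : Measure Ω) [IsProbabilityMeasure P]
    (ξ : ℕ → Ω → S) (h_meas : ∀ i, Measurable fun ω => kind (ξ i ω))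
    (h_indep : iIndepFun (fun i ω => kind (ξ i ω)) P) {p : ℝ} (hp : 0 < p)
    (h_up : ∀ i, P.real {ω | kind (ξ i ω) = .up} = p)
    (h_down : ∀ i, P.real {ω | kind (ξ i ω) = .down} = p)
    (Y : ℕ → Ω → ℝ)
    (hY : ∀ n ω, Y n ω = (florentineCost kind (fun i => ξ i ω) n : ℝ)) :
    (∀ᵐ ω ∂P, ∀ n, FlorentineTerminates kind (fun i => ξ i ω) n) ∧
    (∃ ν : ProbabilityMeasure ℝ, IsShiftedDarlingMandelbrot (1 / 2) ν ∧
      TendstoInDistribution (fun (n : ℕ) (ω : Ω) => Y n ω / (n : ℝ)) atTop (fun x : ℝ => x)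
        (fun _ => P) (ν : Measure ℝ)) ∧
    (∀ n, MemLp (Y n) 2 P) ∧
    (fun n : ℕ => ∫ ω, Y n ω ∂P) ~[atTop] (fun n : ℕ => 2 * (n : ℝ)) ∧
    (fun n : ℕ => variance (Y n) P) ~[atTop] (fun n : ℕ => 4 / 3 * (n : ℝ) ^ 2) := by
  set X : Ω → ℕ → MotzkinKind := fun ω i => kind (ξ i ω)
  have hX : Measurable X := measurable_pi_lambda X h_meas
  obtain ⟨ν, _, h_law, hν_up, hν_down⟩ :=
    exists_map_eq_infinitePi h_meas h_indep h_up h_down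
  have hq := isSurvivalFunction_survivalProb hν_up hν_down hp
  have hqc := tendsto_rpow_half_mul_survivalProb hν_up hν_down hp
  have hc : Real.pi⁻¹ * √(Real.pi / p) ≠ 0 := by positivity
  let Z (n : ℕ) (ω : Ω) : ℕ := florentineCost id (X ω) n
  have hZ (n : ℕ) : Measurable (Z n) := (measurable_florentineCost n).comp hX
  have h_prob (n : ℕ) : IsProbabilityMeasure (P.map (Z n)) :=
    Measure.isProbabilityMeasure_map (hZ n).aemeasurable
  have h_renewal (n : ℕ) : IsRenewalLaw (fun n => survivalProb ν n 0) n (P.map (Z n)) := by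
    have h := isRenewalLaw_map_florentineCost hq n
    rwa [← h_law, Measure.map_map (measurable_florentineCost n) hX] at h
  obtain rfl : Y = fun n ω => (Z n ω : ℝ) :=
    funext₂ fun n ω => (hY n ω).trans (congrArg _ florentineCost_comp.symm)
  refine ⟨ae_all_iff.2 fun n => ?_, ?_, fun n => ?_, ?_, ?_⟩
  · exact (ae_of_ae_map hX.aemeasurable (h_law ▸ ae_florentineTerminates hq n)).mono fun ω =>
      florentineTerminates_comp_iff.1
  · exact IsRenewalLaw.exists_tendstoInDistribution hZ h_renewal hq one_half_pos.le
      one_half_lt_one hc hqc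
  · exact ((h_renewal n).memLp_two hq).comp_of_map (hZ n).aemeasurable
  · have h := IsRenewalLaw.isEquivalent_integral_natCast h_renewal hq one_half_lt_one hc hqc
    simp only [integral_map (hZ _).aemeasurable AEStronglyMeasurable.of_discrete] at h
    exact (by norm_num : (1 - 1 / 2 : ℝ)⁻¹ = 2) ▸ h
  · have h := IsRenewalLaw.isEquivalent_variance_natCast h_renewal hq one_half_lt_one hc hqc
      one_half_pos.ne'
    simp only [variance_map AEMeasurable.of_discrete (hZ _).aemeasurable] at h
    exact (by norm_num : (1 / 2 / ((1 - 1 / 2) ^ 2 * (2 - 1 / 2)) : ℝ) = 4 / 3) ▸ h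

theorem proposition1 {S : Type*} [Fintype S] [MeasurableSpace S] [MeasurableSingletonClass S]
    (kind : S → MotzkinKind)
    (h_up : 0 < Fintype.card {s : S // kind s = MotzkinKind.up})
    (h_eq : Fintype.card {s : S // kind s = MotzkinKind.up} =
      Fintype.card {s : S // kind s = MotzkinKind.down})
    {Ω : Type*} [MeasurableSpace Ω] (P : Measure Ω) [IsProbabilityMeasure P]
    (ξ : ℕ → Ω → S) (h_meas : ∀ i, Measurable (ξ i)) (h_indep : iIndepFun ξ P)
    (h_unif : ∀ i s, P {ω | ξ i ω = s} = (Fintype.card S : ℝ≥0∞)⁻¹)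
    (Y : ℕ → Ω → ℝ)
    (hY : ∀ n ω, Y n ω = (florentineCost kind (fun i => ξ i ω) n : ℝ)) :
    (∀ᵐ ω ∂P, ∀ n, FlorentineTerminates kind (fun i => ξ i ω) n) ∧
    (∃ ν : ProbabilityMeasure ℝ, IsShiftedDarlingMandelbrot (1 / 2) ν ∧
      TendstoInDistribution (fun (n : ℕ) (ω : Ω) => Y n ω / (n : ℝ)) atTop (fun x : ℝ => x)
        (fun _ => P) (ν : Measure ℝ)) ∧
    (∀ n, MemLp (Y n) 2 P) ∧
    (fun n : ℕ => ∫ ω, Y n ω ∂P) ~[atTop] (fun n : ℕ => 2 * (n : ℝ)) ∧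
    (fun n : ℕ => variance (Y n) P) ~[atTop] (fun n : ℕ => 4 / 3 * (n : ℝ) ^ 2) := by
  have h_kind : ∀ κ i, P.real {ω | kind (ξ i ω) = κ} = _ := fun κ i =>
    measureReal_of_uniform (h_meas i) (h_unif i) (kind · = κ)
  have := h_up.trans_le (Fintype.card_subtype_le _)
  exact proposition1_general kind P ξ (fun i => Measurable.of_discrete.comp (h_meas i))
    (h_indep.comp (fun _ => kind) fun _ => .of_discrete) (by positivity) (h_kind .up)
    (fun i => (h_kind .down i).trans (by rw [h_eq])) Y hY
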